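/- **Setting.** Let $(\mathcal M,\mu)$, $(\mathcal N,\nu)$ be arbitrary measure spaces and let functions be real- or complex-valued. For a $\mu$-measurable $f$ put $\lambda_f^\mu(y)=\mu\{|f|>y\}$, $f^*_\mu(t)=\inf\{y>0:\lambda^\mu_f(y)\le t\}$ for $t>0$, $$\|f\|_{L^{p,1}(\mu)}=\int_0^\infty t^{\frac1p-1}f^*_\mu(t)\,dt,\qquad \|f\|_{L^{p,\infty}(\mu)}=\sup_{t>0}t^{\frac1p}f^*_\mu(t).$$ A function $\varphi:[1,\infty)\to[1,\infty)$ is *admissible* if $\varphi(1)=1$, $\log\varphi$ is concave, $\varphi$ is differentiable, and there are $\gamma,\beta>0$ with $\frac\gamma x\le\frac{\varphi'(x)}{\varphi(x)}\le\frac\beta x$ for all $x\ge1$. For $F\ge0$ on $(0,\infty)$ and $t>0$ put $$R_{p_0,p_1,\varphi}F(t)=\frac1{t^{1/p_0}}\int_0^t\varphi\Big(1-\log\frac rt\Big)F(r)\frac{dr}{r^{1-1/p_0}}+\frac1{t^{1/p_1}}\int_t^\infty F(r)\frac{dr}{r^{1-1/p_1}}.$$ A *sublinear operator* $T$ is a map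 from a linear space $D$ of ($\mu$-a.e. classes of) $\mu$-measurable functions to the ($\nu$-a.e. classes of) $\nu$-measurable functions such that $|T(f+g)|\le|Tf|+|Tg|$ and $|T(cf)|=|c||Tf|$ $\nu$-a.e. for all $f,g\in D$ and scalars $c$. For $1<p_0<p_1<\infty$ let $\Sigma_{p_0,p_1}$ be the linear span of $\bigcup_{p_0<p\le p_1}L^{p,1}(\mu)$. **Theorem 3.1.** Let $1<p_0<p_1<\infty$, let $\varphi$ be admissible and let $T$ be a sublinear operator with domain $D$. (1) Let $C>0$, and suppose that for every $p_0<p\le p_1$ one has $L^{p,1}(\mu)\subseteq D$ and $$\|Tf\|_{L^{p,\infty}(\nu)}\le C\,\varphi\Big(\Big[\frac1{p_0}-\frac1p\Big]^{-1}\Big)\|f\|_{L^{p,1}(\mu)}\qquad\text{for all } f\in L^{p,1}(\mu).\tag{$*$}$$ Then $$(Tf)^*_\nu(t)\le\frac{K}{p_0-1}\,R_{p_0,p_1,\varphi}(f^*_\mu)(t)\qquad\text{for all } t>0$$ for every $f\in\Sigma_{p_0,p_1}$, and more generally for every $f\in D$ for which there are $f_n\in\Sigma_{p_0,p_1}$ with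 $|f_n|\le|f|$ $\mu$-a.e. and $|Tf|\le\liminf_n|Tf_n|$ $\nu$-a.e. Here the constant $K>0$ is independent of $f$, $t$, $T$ and the measure spaces, and for each $q\in(1,p_1)$ it can be chosen to depend only on $\varphi,p_1,C,q$, uniformly in $p_0\in(1,q]$. (2) Conversely, let $c>0$ and suppose that $\Sigma_{p_0,p_1}\subseteq D$ and that $(Tf)^*_\nu(t)\le c\,R_{p_0,p_1,\varphi}(f^*_\mu)(t)$ for every $f\in\Sigma_{p_0,p_1}$ and every $t>0$. Then $(*)$ holds for every $p_0<p\le p_1$, with a constant $C>0$ depending only on $\varphi$, $p_1$ and $c$ (and not on $p$). -/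

import Mathlib

open MeasureTheory Set Filter
open scoped ENNReal

noncomputable section

/-- Admissible functions. Only the restriction of `φ` to `[1, ∞)` matters; condition (b) forces
`φ` to be finite there, and a value at `∞` is never used. The derivative at the
endpoint `1` is one-sided. -/
structure IsAdmissible (φ : ℝ → ℝ) : Prop where
  one_le : ∀ x, 1 ≤ x → 1 ≤ φ x
  map_one : φ 1 = 1
  logConcave : ConcaveOn ℝ (Ici 1) (fun x => Real.log (φ x))
  differentiable : DifferentiableOn ℝ φ (Ici 1)
  logDeriv_bounds : ∃ γ β : ℝ, 0 < γ ∧ 0 < β ∧ ∀ x, 1 ≤ x →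
    γ / x ≤ derivWithin φ (Ici 1) x / φ x ∧ derivWithin φ (Ici 1) x / φ x ≤ β / x

section Rearrangement

variable {M : Type*} [MeasurableSpace M] {𝕜 : Type*} [RCLike 𝕜]

/-- The distribution function `λ_f(y) = μ {|f| > y}`. -/
def distribution (μ : Measure M) (f : M → 𝕜) (y : ℝ≥0∞) : ℝ≥0∞ :=
  μ {x | y < ‖f x‖ₑ}

/-- The decreasing rearrangement `f^*(t) = inf {y > 0 : λ_f(y) ≤ t}`, with value `∞` if no finite
`y` qualifies. -/
def rearrangement (μ : Measure M) (f : M → 𝕜) (t : ℝ) : ℝ≥0∞ :=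
  sInf {y : ℝ≥0∞ | 0 < y ∧ distribution μ f y ≤ ENNReal.ofReal t}

/-- `‖f‖_{L^{p,1}(μ)} = ∫_0^∞ t^{1/p - 1} f^*(t) dt`. -/
def lorentzNorm (μ : Measure M) (p : ℝ) (f : M → 𝕜) : ℝ≥0∞ :=
  ∫⁻ t in Ioi (0 : ℝ), ENNReal.ofReal (t ^ (1 / p - 1)) * rearrangement μ f t

/-- `‖f‖_{L^{p,∞}(μ)} = sup_{t > 0} t^{1/p} f^*(t)`. -/
def weakLorentzNorm (μ : Measure M) (p : ℝ) (f : M → 𝕜) : ℝ≥0∞ :=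
  ⨆ (t : ℝ) (_ : 0 < t), ENNReal.ofReal (t ^ (1 / p)) * rearrangement μ f t

variable (𝕜) in
/-- The algebraic sum of the spaces `L^{p,1}(μ)`, `p₀ < p ≤ p₁`, inside the space of (a.e. classes
of) measurable functions. -/
def lorentzSum (μ : Measure M) (p₀ p₁ : ℝ) : Submodule 𝕜 (M →ₘ[μ] 𝕜) :=
  Submodule.span 𝕜 {f | ∃ p, p₀ < p ∧ p ≤ p₁ ∧ lorentzNorm μ p f < ∞}

end Rearrangement

section Calderon

/-- `P_{p₀,φ} F(t) = t^{-1/p₀} ∫_0^t φ(1 - log (r/t)) F(r) r^{1/p₀ - 1} dr`. -/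
def calderonP (p₀ : ℝ) (φ : ℝ → ℝ) (F : ℝ → ℝ≥0∞) (t : ℝ) : ℝ≥0∞ :=
  ENNReal.ofReal (t ^ (-(1 / p₀))) *
    ∫⁻ r in Ioo 0 t,
      ENNReal.ofReal (φ (1 - Real.log (r / t))) * F r * ENNReal.ofReal (r ^ (1 / p₀ - 1))

/-- `Q_{p₁} F(t) = t^{-1/p₁} ∫_t^∞ F(r) r^{1/p₁ - 1} dr`. -/
def calderonQ (p₁ : ℝ) (F : ℝ → ℝ≥0∞) (t : ℝ) : ℝ≥0∞ :=
  ENNReal.ofReal (t ^ (-(1 / p₁))) *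
    ∫⁻ r in Ioi t, F r * ENNReal.ofReal (r ^ (1 / p₁ - 1))

/-- The generalized Calderón operator `R_{p₀,p₁,φ} = P_{p₀,φ} + Q_{p₁}`. -/
def calderonR (p₀ p₁ : ℝ) (φ : ℝ → ℝ) (F : ℝ → ℝ≥0∞) (t : ℝ) : ℝ≥0∞ :=
  calderonP p₀ φ F t + calderonQ p₁ F t

end Calderon

/-- A sublinear operator, defined on a linear subspace of the measurable functions on `(M, μ)`,
with values in the measurable functions on `(N, ν)`. -/
structure SublinearOperator {M N : Type*} [MeasurableSpace M] [MeasurableSpace N]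
    (𝕜 : Type*) [RCLike 𝕜] (μ : Measure M) (ν : Measure N) where
  domain : Submodule 𝕜 (M →ₘ[μ] 𝕜)
  toFun : domain → (N →ₘ[ν] 𝕜)
  map_add_le : ∀ f g : domain, ∀ᵐ y ∂ν, ‖toFun (f + g) y‖ ≤ ‖toFun f y‖ + ‖toFun g y‖
  map_smul_eq : ∀ (c : 𝕜) (f : domain), ∀ᵐ y ∂ν, ‖toFun (c • f) y‖ = ‖c‖ * ‖toFun f y‖

namespace SublinearOperator

variable {M N : Type*} [MeasurableSpace M] [MeasurableSpace N] {𝕜 : Type*} [RCLike 𝕜]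
  {μ : Measure M} {ν : Measure N}

/-- `T : L^{p,1}(μ) → L^{p,∞}(ν)` with norm at most `A`. -/
def RestrictedWeakType (T : SublinearOperator 𝕜 μ ν) (p A : ℝ) : Prop :=
  ∀ f : M →ₘ[μ] 𝕜, lorentzNorm μ p f < ∞ → ∃ hf : f ∈ T.domain,
    weakLorentzNorm ν p (T.toFun ⟨f, hf⟩) ≤ ENNReal.ofReal A * lorentzNorm μ p f

/-- `(Tf)^*_ν(t) ≤ A R_{p₀,p₁,φ}(f^*_μ)(t)` for every `t > 0`. -/
def PointwiseBound (T : SublinearOperator 𝕜 μ ν) (p₀ p₁ : ℝ) (φ : ℝ → ℝ) (A : ℝ)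
    (f : T.domain) : Prop :=
  ∀ t : ℝ, 0 < t → rearrangement ν (T.toFun f) t ≤
    ENNReal.ofReal A * calderonR p₀ p₁ φ (rearrangement μ (f : M →ₘ[μ] 𝕜)) t

/-- `Tf` is controlled by values of `T` on functions in the sum of the `L^{p,1}` spaces: there
are `f_n` in the sum of the spaces `L^{p,1}(μ)`, `p₀ < p ≤ p₁`, with `|f_n| ≤ |f|` and `|Tf| ≤ liminf |T f_n|` a.e.
Every `f` in that sum qualifies, through the constant sequence. -/
def Approximable (T : SublinearOperator 𝕜 μ ν) (p₀ p₁ : ℝ) (f : T.domain) : Prop :=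
  ∃ g : ℕ → T.domain,
    (∀ n, (g n : M →ₘ[μ] 𝕜) ∈ lorentzSum 𝕜 μ p₀ p₁) ∧
    (∀ n, ∀ᵐ x ∂μ, ‖(g n : M →ₘ[μ] 𝕜) x‖ ≤ ‖(f : M →ₘ[μ] 𝕜) x‖) ∧
    ∀ᵐ y ∂ν, ‖T.toFun f y‖ₑ ≤ liminf (fun n => ‖T.toFun (g n) y‖ₑ) atTop

end SublinearOperator

end

/-! ### Decreasing rearrangements. -/

section RearrangementBasics

variable {M : Type*} [MeasurableSpace M] {𝕜 : Type*} [RCLike 𝕜] {μ : Measure M}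

/-! Norm bounds to pointwise bound: fix `t`, write `F = f^*`, `s_k = t e^{-k}`, and cut `f` by
height into a low part `|f| ≤ F(t)`, slices `F(s_k) < |f| ≤ F(s_{k+1})` for `k < n`, and a remaining
top. Each slice lives on a set of measure at most `s_k`, and it gets its own exponent `p_k`, chosen
so that `(1/p₀ - 1/p_k)⁻¹ = D + k` with `D = (1/q - 1/p₁)⁻¹`. Then `p_k` is so close to `p₀` that
`s_k^{1/p_k}` is comparable to `t^{1/p_k} e^{-k/p₀}`, while log-concavity bounds the operator norm
through `φ(D + k) ≤ φ(D) φ(1 + k)`. The slice therefore costs about as much as the part of `P_{p₀,φ}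
F(t)` over `(s_{k+2}, s_{k+1}]`, and these intervals are disjoint. The low part, treated with
exponent `p₁`, gives `F(t)` and `Q_{p₁} F(t)`; the top, treated with one fixed exponent, vanishes as
`n → ∞`.

The pieces carry different weak-type bounds, and infinitely many quasi-triangle inequalities would
ruin the constant. `rearrangement_sum_le` adds all bounds at once: subtract from each piece its
natural height, integrate the excess, and apply Chebyshev to the sum. Its loss is `p₀/(p₀ - 1)`, the
source of the factor `1/(p₀ - 1)`.

Pointwise bound to norm bounds: `φ(1 + u) ≤ C φ(1/δ) e^{δu}` with `u = log(t/r)` and `δ = 1/p₀ -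
1/p` turns the kernel of `P_{p₀,φ}` into that of the `L^{p,1}` norm (`exists_le_mul_exp`,
`rpow_mul_calderonP_le`). -/

theorem distribution_anti (f : M → 𝕜) : Antitone (distribution μ f) := fun _ _ h =>
  measure_mono fun _ hx => lt_of_le_of_lt h hx

theorem distribution_mono_ae {f g : M → 𝕜} (h : ∀ᵐ x ∂μ, ‖f x‖ₑ ≤ ‖g x‖ₑ) (y : ℝ≥0∞) :
    distribution μ f y ≤ distribution μ g y :=
  measure_mono_ae <| by
    filter_upwards [h] with x hx hy
    exact lt_of_lt_of_le hy hx

/-- The infimum is attained: `{|f| > b}` is the increasing union of `{|f| > u_n}` for `u_n ↓ b`, so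
continuity from below applies. Rearrangement estimates thereby reduce to measures of level sets. -/
theorem rearrangement_le_iff {f : M → 𝕜} {t : ℝ} {b : ℝ≥0∞} :
    rearrangement μ f t ≤ b ↔ distribution μ f b ≤ ENNReal.ofReal t := by
  constructor
  · intro h
    rcases eq_or_ne b ∞ with rfl | hb
    · simp [distribution]
    obtain ⟨u, hu, hub, hul⟩ := exists_seq_strictAnti_tendsto' (lt_top_iff_ne_top.2 hb)
    have hset : {x | b < ‖f x‖ₑ} = ⋃ n, {x | u n < ‖f x‖ₑ} := by
      ext x
      simp only [mem_ofPred_eq, mem_iUnion]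
      refine ⟨fun hx => (hul.eventually_lt_const hx).exists, ?_⟩
      rintro ⟨n, hn⟩
      exact (hub n).1.trans hn
    have hmono : Monotone fun n => {x | u n < ‖f x‖ₑ} := fun m n hmn x hx =>
      lt_of_le_of_lt (hu.antitone hmn) hx
    rw [distribution, hset, hmono.measure_iUnion]
    refine iSup_le fun n => ?_
    obtain ⟨y, hy, hyu⟩ := sInf_lt_iff.1 (lt_of_le_of_lt h (hub n).1)
    exact (distribution_anti f hyu.le).trans hy.2
  · intro h
    refine le_of_forall_gt fun y hy => ?_
    obtain ⟨z, hbz, hzy⟩ := exists_between hy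
    exact lt_of_le_of_lt (sInf_le ⟨bot_lt_of_lt hbz, (distribution_anti f hbz.le).trans h⟩) hzy

theorem distribution_rearrangement_le (f : M → 𝕜) (t : ℝ) :
    distribution μ f (rearrangement μ f t) ≤ ENNReal.ofReal t :=
  rearrangement_le_iff.1 le_rfl

theorem rearrangement_anti (f : M → 𝕜) : Antitone (rearrangement μ f) := fun _ _ h =>
  rearrangement_le_iff.2 <| (distribution_rearrangement_le f _).trans (ENNReal.ofReal_le_ofReal h)

theorem rearrangement_mono_ae {f g : M → 𝕜} (h : ∀ᵐ x ∂μ, ‖f x‖ₑ ≤ ‖g x‖ₑ) (t : ℝ) :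
    rearrangement μ f t ≤ rearrangement μ g t :=
  rearrangement_le_iff.2 <| (distribution_mono_ae h _).trans (distribution_rearrangement_le g t)

theorem rearrangement_add_le {f g h : M → 𝕜} (hh : ∀ᵐ x ∂μ, ‖h x‖ₑ ≤ ‖f x‖ₑ + ‖g x‖ₑ)
    {t : ℝ} (ht : 0 < t) :
    rearrangement μ h t ≤ rearrangement μ f (t / 2) + rearrangement μ g (t / 2) := by
  rw [rearrangement_le_iff]
  set a := rearrangement μ f (t / 2)
  set b := rearrangement μ g (t / 2)
  calc distribution μ h (a + b) ≤ μ ({x | a < ‖f x‖ₑ} ∪ {x | b < ‖g x‖ₑ}) := by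
        refine measure_mono_ae ?_
        filter_upwards [hh] with x hx hy
        by_contra hcon
        have : ¬ a < ‖f x‖ₑ ∧ ¬ b < ‖g x‖ₑ := not_or.1 hcon
        exact absurd (lt_of_lt_of_le hy hx)
          (not_lt.2 (add_le_add (not_lt.1 this.1) (not_lt.1 this.2)))
    _ ≤ distribution μ f a + distribution μ g b := measure_union_le _ _
    _ ≤ ENNReal.ofReal (t / 2) + ENNReal.ofReal (t / 2) :=
        add_le_add (distribution_rearrangement_le f _) (distribution_rearrangement_le g _)
    _ = ENNReal.ofReal t := by
        rw [← ENNReal.ofReal_add (by positivity) (by positivity), add_halves]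

theorem rearrangement_smul_le {f g : M → 𝕜} (c : 𝕜) (hg : ∀ᵐ x ∂μ, ‖g x‖ₑ ≤ ‖c‖ₑ * ‖f x‖ₑ)
    (t : ℝ) : rearrangement μ g t ≤ ‖c‖ₑ * rearrangement μ f t := by
  rw [rearrangement_le_iff]
  refine le_trans (measure_mono_ae ?_) (distribution_rearrangement_le f t)
  filter_upwards [hg] with x hx hy
  exact lt_of_mul_lt_mul_left' (lt_of_lt_of_le hy hx)

theorem rearrangement_le_of_ae_le {f : M → 𝕜} {b : ℝ≥0∞} (h : ∀ᵐ x ∂μ, ‖f x‖ₑ ≤ b) (t : ℝ) :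
    rearrangement μ f t ≤ b := by
  rw [rearrangement_le_iff]
  have : distribution μ f b = 0 := by
    rw [distribution, measure_eq_zero_iff_ae_notMem]
    filter_upwards [h] with x hx
    exact not_lt.2 hx
  simp [this]

theorem rearrangement_eq_zero_of_support {f : M → 𝕜} {S : Set M} {s t : ℝ}
    (h : ∀ᵐ x ∂μ, x ∉ S → f x = 0) (hS : μ S ≤ ENNReal.ofReal s) (hst : s ≤ t) :
    rearrangement μ f t = 0 := by
  rw [← nonpos_iff_eq_zero, rearrangement_le_iff]
  refine le_trans (measure_mono_ae ?_) (hS.trans (ENNReal.ofReal_le_ofReal hst))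
  filter_upwards [h] with x hx hy
  by_contra hxS
  have hy' : 0 < ‖f x‖ₑ := hy
  simp [hx hxS] at hy'

/-- Fatou for level sets: where `|f| > b`, all late `|g n|` exceed `b`, and the tail intersections
increase while each lies in a single level set. -/
theorem rearrangement_le_of_liminf {g : ℕ → M → 𝕜} {f : M → 𝕜} {t : ℝ} {b : ℝ≥0∞}
    (h : ∀ᵐ x ∂μ, ‖f x‖ₑ ≤ liminf (fun n => ‖g n x‖ₑ) atTop)
    (hg : ∀ n, rearrangement μ (g n) t ≤ b) : rearrangement μ f t ≤ b := by
  rw [rearrangement_le_iff]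
  have hmono : Monotone fun n => ⋂ i ≥ n, {x | b < ‖g i x‖ₑ} := fun m n hmn =>
    biInter_mono (fun i (hi : n ≤ i) => le_trans hmn hi) fun _ _ => subset_rfl
  calc distribution μ f b ≤ μ (⋃ n, ⋂ i ≥ n, {x | b < ‖g i x‖ₑ}) := by
        refine measure_mono_ae ?_
        filter_upwards [h] with x hx hy
        have hlt : b < liminf (fun n => ‖g n x‖ₑ) atTop := lt_of_lt_of_le hy hx
        obtain ⟨n, hn⟩ := eventually_atTop.1 (eventually_lt_of_lt_liminf hlt)
        exact mem_iUnion.2 ⟨n, mem_iInter₂.2 hn⟩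
    _ ≤ ENNReal.ofReal t := by
        rw [hmono.measure_iUnion]
        refine iSup_le fun n => le_trans (measure_mono ?_) (rearrangement_le_iff.1 (hg n))
        exact biInter_subset_of_mem (le_refl n)

end RearrangementBasics

/-! ### Two explicit power integrals. -/

section PowerIntegrals

theorem setLIntegral_Ioo_rpow {p s : ℝ} (hp : 0 < p) (hs : 0 < s) :
    ∫⁻ r in Ioo 0 s, ENNReal.ofReal (r ^ (1 / p - 1)) = ENNReal.ofReal (p * s ^ (1 / p)) := by
  have hlt : -1 < 1 / p - 1 := by have := one_div_pos.2 hp; linarith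
  rw [setLIntegral_congr Ioo_ae_eq_Ioc, ← ofReal_integral_eq_lintegral_ofReal,
    ← intervalIntegral.integral_of_le hs.le, integral_rpow (Or.inl hlt)]
  · congr 1
    rw [sub_add_cancel, Real.zero_rpow (one_div_pos.2 hp).ne']
    field_simp
    ring
  · exact (intervalIntegrable_iff_integrableOn_Ioc_of_le hs.le).1
      (intervalIntegral.intervalIntegrable_rpow' hlt)
  · filter_upwards [ae_restrict_mem measurableSet_Ioc] with r hr
    exact Real.rpow_nonneg hr.1.le _

theorem lintegral_div_add_rpow {a p : ℝ} (ha : 0 < a) (hp : 1 < p) :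
    ∫⁻ y in Ioi (0 : ℝ), ENNReal.ofReal ((a / (a + y)) ^ p) = ENNReal.ofReal (a / (p - 1)) := by
  have h1 : ∫⁻ y in Ioi (0 : ℝ), ENNReal.ofReal ((a / (a + y)) ^ p)
      = ∫⁻ y in Ioi a, ENNReal.ofReal (a ^ p * y ^ (-p)) := by
    have hmp := (measurePreserving_add_left (volume : Measure ℝ) a).setLIntegral_comp_emb
      (measurableEmbedding_addLeft a) (fun y => ENNReal.ofReal (a ^ p * y ^ (-p))) (Ioi 0)
    simp only [image_const_add_Ioi, add_zero] at hmp
    rw [← hmp]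
    refine setLIntegral_congr_fun measurableSet_Ioi fun y hy => ?_
    have hy' : 0 < a + y := add_pos ha hy
    rw [Real.div_rpow ha.le hy'.le, Real.rpow_neg hy'.le, div_eq_mul_inv]
  rw [h1, ← ofReal_integral_eq_lintegral_ofReal]
  · rw [integral_const_mul, integral_Ioi_rpow_of_lt (by linarith) ha]
    congr 1
    rw [Real.rpow_add ha, Real.rpow_neg ha.le, Real.rpow_one]
    have := (Real.rpow_pos_of_pos ha p).ne'
    have h2 : p - 1 ≠ 0 := by linarith
    have h3 : -p + 1 ≠ 0 := by linarith
    field_simp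
    ring
  · exact (integrableOn_Ioi_rpow_of_lt (by linarith) ha).const_mul _
  · filter_upwards [ae_restrict_mem measurableSet_Ioi] with r hr
    have : 0 < r := ha.trans hr
    positivity

end PowerIntegrals

/-! ### Adding weak-type bounds with different exponents. -/

section WeakTypeSums

variable {N : Type*} [MeasurableSpace N] {𝕜 : Type*} [RCLike 𝕜] {ν : Measure N}

theorem distribution_le_of_weakLorentzNorm_le {g : N → 𝕜} {p t a y : ℝ} (hp : 0 < p)
    (ht : 0 < t) (ha : 0 < a) (hy : 0 < y)
    (hg : weakLorentzNorm ν p g ≤ ENNReal.ofReal (t ^ (1 / p) * a)) :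
    distribution ν g (ENNReal.ofReal y) ≤ ENNReal.ofReal (t * (a / y) ^ p) := by
  rw [← rearrangement_le_iff]
  have hs : 0 < t * (a / y) ^ p := by positivity
  have h := (le_iSup₂ (f := fun (s : ℝ) (_ : 0 < s) =>
    ENNReal.ofReal (s ^ (1 / p)) * rearrangement ν g s) _ hs).trans hg
  have hpow : (t * (a / y) ^ p) ^ (1 / p) = t ^ (1 / p) * (a / y) := by
    rw [Real.mul_rpow ht.le (by positivity), ← Real.rpow_mul (by positivity),
      mul_one_div_cancel hp.ne', Real.rpow_one]
  rw [hpow] at h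
  have hc : 0 < t ^ (1 / p) * (a / y) := by positivity
  have he : t ^ (1 / p) * a = t ^ (1 / p) * (a / y) * y := by field_simp
  rw [he, ENNReal.ofReal_mul hc.le] at h
  exact (ENNReal.mul_le_mul_iff_right (ENNReal.ofReal_pos.2 hc).ne' ENNReal.ofReal_ne_top).1 h

/-- By the layer-cake formula, the weak-type bound `ν{|g| > a + y} ≤ t (a/(a + y))^p` is integrated
over `y > 0`; `p > 1` makes it converge. -/
theorem lintegral_tsub_le_of_weakLorentzNorm_le {g : N → 𝕜} (hgm : AEStronglyMeasurable g ν)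
    {p t : ℝ} (hp : 1 < p) (ht : 0 < t) {a : ℝ≥0∞}
    (hg : weakLorentzNorm ν p g ≤ ENNReal.ofReal (t ^ (1 / p)) * a) :
    ∫⁻ x, (‖g x‖ₑ - a) ∂ν ≤ ENNReal.ofReal (t / (p - 1)) * a := by
  have hp0 : 0 < p := by linarith
  rcases eq_or_ne a ∞ with rfl | hatop
  · simp
  lift a to NNReal using hatop
  -- The level-set bound needs `a > 0`; for `a = 0` the function vanishes almost everywhere.
  rcases eq_or_ne a 0 with rfl | ha0
  · have hr : ∀ s, 0 < s → rearrangement ν g s = 0 := fun s hs => by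
      have h := (le_iSup₂ (f := fun (s : ℝ) (_ : 0 < s) =>
        ENNReal.ofReal (s ^ (1 / p)) * rearrangement ν g s) s hs).trans hg
      have hs' : (0 : ℝ) < s ^ (1 / p) := by positivity
      rw [ENNReal.coe_zero, mul_zero, nonpos_iff_eq_zero, mul_eq_zero] at h
      exact h.resolve_left (ENNReal.ofReal_pos.2 hs').ne'
    have hz : distribution ν g 0 = 0 := by
      refine nonpos_iff_eq_zero.1 (ENNReal.le_of_forall_pos_le_add fun ε hε _ => ?_)
      rw [zero_add, ← ENNReal.ofReal_coe_nnreal]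
      exact rearrangement_le_iff.1 (hr ε hε).le
    have hae : ∀ᵐ x ∂ν, ‖g x‖ₑ - ((0 : NNReal) : ℝ≥0∞) = 0 := by
      rw [distribution, measure_eq_zero_iff_ae_notMem] at hz
      filter_upwards [hz] with x hx
      simpa using hx
    rw [lintegral_congr_ae hae, lintegral_zero]
    exact zero_le
  · have ha : (0 : ℝ) < a := by positivity
    have hg' : weakLorentzNorm ν p g ≤ ENNReal.ofReal (t ^ (1 / p) * a) := by
      rwa [ENNReal.ofReal_mul (by positivity), ENNReal.ofReal_coe_nnreal]
    calc ∫⁻ x, (‖g x‖ₑ - a) ∂ν = ∫⁻ x, ENNReal.ofReal (max (‖g x‖ - a) 0) ∂ν := by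
          refine lintegral_congr fun x => ?_
          rw [← ENNReal.ofReal_coe_nnreal, ← ofReal_norm,
            ← ENNReal.ofReal_sub _ a.coe_nonneg]
          rcases le_total (‖g x‖ - a) 0 with h | h
          · rw [max_eq_right h, ENNReal.ofReal_of_nonpos h, ENNReal.ofReal_zero]
          · rw [max_eq_left h]
      _ = ∫⁻ y in Ioi (0 : ℝ), ν {x | y < max (‖g x‖ - a) 0} := by
          refine lintegral_eq_lintegral_meas_lt ν (Eventually.of_forall fun x => le_max_right _ _) ?_
          exact (hgm.norm.aemeasurable.sub_const _).max aemeasurable_const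
      _ ≤ ∫⁻ y in Ioi (0 : ℝ), ENNReal.ofReal t * ENNReal.ofReal ((a / (a + y)) ^ p) := by
          refine setLIntegral_mono' measurableSet_Ioi fun y hy => ?_
          have hy0 : (0 : ℝ) < y := hy
          rw [← ENNReal.ofReal_mul ht.le]
          refine le_trans (measure_mono fun x hx => ?_)
            (distribution_le_of_weakLorentzNorm_le hp0 ht ha (add_pos ha hy0) hg')
          have hx' : y < max (‖g x‖ - a) 0 := hx
          have : y < ‖g x‖ - a := by
            rcases lt_max_iff.1 hx' with h | h
            · exact h
            · linarith
          show ENNReal.ofReal _ < ‖g x‖ₑ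
          rw [← ofReal_norm]
          exact (ENNReal.ofReal_lt_ofReal_iff (by linarith)).2 (by linarith)
      _ = ENNReal.ofReal (t / (p - 1)) * a := by
          rw [lintegral_const_mul' _ _ ENNReal.ofReal_ne_top, lintegral_div_add_rpow ha hp,
            ← ENNReal.ofReal_mul ht.le, mul_div_left_comm, mul_comm, ENNReal.ofReal_mul' ha.le,
            ENNReal.ofReal_coe_nnreal]

/-- Weak-type bounds with exponents bounded away from `1` can be summed pointwise. -/
theorem rearrangement_sum_le {ι : Type*} (s : Finset ι) {h : N → 𝕜} {g : ι → N → 𝕜}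
    (hgm : ∀ i ∈ s, AEStronglyMeasurable (g i) ν) {p : ι → ℝ} {p₀ t : ℝ} (hp₀ : 1 < p₀)
    (hp : ∀ i ∈ s, p₀ ≤ p i) (ht : 0 < t) {a : ι → ℝ≥0∞}
    (hg : ∀ i ∈ s, weakLorentzNorm ν (p i) (g i) ≤ ENNReal.ofReal (t ^ (1 / p i)) * a i)
    (hh : ∀ᵐ x ∂ν, ‖h x‖ₑ ≤ ∑ i ∈ s, ‖g i x‖ₑ) :
    rearrangement ν h t ≤ ENNReal.ofReal (p₀ / (p₀ - 1)) * ∑ i ∈ s, a i := by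
  have hq : 0 < p₀ - 1 := by linarith
  set A := ∑ i ∈ s, a i
  refine le_of_forall_gt_imp_ge_of_dense fun y hy => ?_
  rcases eq_or_ne y ∞ with rfl | hytop
  · exact le_top
  rw [rearrangement_le_iff]
  have hsplit : ENNReal.ofReal (p₀ / (p₀ - 1)) * A = A + ENNReal.ofReal (1 / (p₀ - 1)) * A := by
    have : p₀ / (p₀ - 1) = 1 + 1 / (p₀ - 1) := by field_simp; ring
    rw [this, ENNReal.ofReal_add zero_le_one (by positivity), ENNReal.ofReal_one, add_mul, one_mul]
  rw [hsplit] at hy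
  have hAtop : A ≠ ∞ := ne_top_of_lt (lt_of_le_of_lt le_self_add hy)
  -- Where `|h| > y`, the excesses `|g i| - a i` sum to at least `y - A`. Their total integral is at
  -- most `t A/(p₀ - 1) ≤ t (y - A)`, so Chebyshev gives measure at most `t`.
  have hz : ENNReal.ofReal (1 / (p₀ - 1)) * A < y - A := lt_tsub_iff_left.2 hy
  have hz0 : y - A ≠ 0 := (bot_lt_of_lt hz).ne'
  have hztop : y - A ≠ ∞ := ENNReal.sub_ne_top hytop
  have hint : ∫⁻ x, ∑ i ∈ s, (‖g i x‖ₑ - a i) ∂ν ≤ ENNReal.ofReal t * (y - A) := by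
    calc ∫⁻ x, ∑ i ∈ s, (‖g i x‖ₑ - a i) ∂ν = ∑ i ∈ s, ∫⁻ x, (‖g i x‖ₑ - a i) ∂ν :=
          lintegral_finsetSum' _ fun i hi => (hgm i hi).enorm.sub aemeasurable_const
      _ ≤ ∑ i ∈ s, ENNReal.ofReal (t * (1 / (p₀ - 1))) * a i := by
          refine Finset.sum_le_sum fun i hi => ?_
          have hpi := hp i hi
          refine (lintegral_tsub_le_of_weakLorentzNorm_le (hgm i hi) (by linarith) ht
            (hg i hi)).trans ?_
          gcongr
          rw [mul_one_div]
          gcongr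
      _ = ENNReal.ofReal t * (ENNReal.ofReal (1 / (p₀ - 1)) * A) := by
          rw [← Finset.mul_sum, ENNReal.ofReal_mul ht.le, mul_assoc]
      _ ≤ _ := by gcongr
  have hcheb := (mul_meas_ge_le_lintegral₀
    (Finset.aemeasurable_fun_sum s fun i hi => (hgm i hi).enorm.sub aemeasurable_const)
    (y - A)).trans hint
  rw [mul_comm (ENNReal.ofReal t)] at hcheb
  refine le_trans (measure_mono_ae ?_) ((ENNReal.mul_le_mul_iff_right hz0 hztop).1 hcheb)
  filter_upwards [hh] with x hx hyx
  have hyx' : y < ‖h x‖ₑ := hyx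
  show y - A ≤ ∑ i ∈ s, (‖g i x‖ₑ - a i)
  rw [tsub_le_iff_right, ← Finset.sum_add_distrib]
  exact hyx'.le.trans (hx.trans (Finset.sum_le_sum fun i _ => le_tsub_add))

end WeakTypeSums

/-! ### Growth of admissible functions. -/

namespace IsAdmissible

variable {φ : ℝ → ℝ}

theorem pos (hφ : IsAdmissible φ) {x : ℝ} (hx : 1 ≤ x) : 0 < φ x :=
  lt_of_lt_of_le one_pos (hφ.one_le x hx)

theorem hasDerivAt (hφ : IsAdmissible φ) {x : ℝ} (hx : 1 < x) :
    HasDerivAt φ (derivWithin φ (Ici 1) x) x :=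
  ((hφ.differentiable x hx.le).hasDerivWithinAt).hasDerivAt (Ici_mem_nhds hx)

theorem monotoneOn (hφ : IsAdmissible φ) : MonotoneOn φ (Ici 1) := by
  obtain ⟨γ, β, hγ, -, hb⟩ := hφ.logDeriv_bounds
  refine monotoneOn_of_deriv_nonneg (convex_Ici 1) hφ.differentiable.continuousOn
    (hφ.differentiable.mono interior_subset) fun x hx => ?_
  rw [interior_Ici] at hx
  have hx1 : (1 : ℝ) < x := hx
  rw [(hφ.hasDerivAt hx1).deriv]
  have h := (div_nonneg hγ.le (by linarith)).trans (hb x hx1.le).1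
  by_contra hneg
  exact absurd h (not_le.2 (div_neg_of_neg_of_pos (not_le.1 hneg) (hφ.pos hx1.le)))

/-- Concavity of `log φ` and `log φ(1) = 0` make `u ↦ log φ(1 + u)` subadditive: `x` and `1 + a` are
convex combinations of `1` and `x + a` with swapped weights. -/
theorem map_add_le_mul (hφ : IsAdmissible φ) {x a : ℝ} (hx : 1 ≤ x) (ha : 0 ≤ a) :
    φ (x + a) ≤ φ x * φ (1 + a) := by
  rcases hx.eq_or_lt with rfl | hx1
  · rw [hφ.map_one, one_mul]
  have hD : 0 < x + a - 1 := by linarith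
  set w := a / (x + a - 1) with hw
  have hw0 : 0 ≤ w := by positivity
  have hw1 : w ≤ 1 := (div_le_one hD).2 (by linarith)
  have hwD : w * (x + a - 1) = a := div_mul_cancel₀ _ hD.ne'
  have h1 := hφ.logConcave.2 (mem_Ici.2 le_rfl) (mem_Ici.2 (by linarith : 1 ≤ x + a)) hw0
    (sub_nonneg.2 hw1) (add_sub_cancel _ _)
  have h2 := hφ.logConcave.2 (mem_Ici.2 le_rfl) (mem_Ici.2 (by linarith : 1 ≤ x + a))
    (sub_nonneg.2 hw1) hw0 (sub_add_cancel _ _)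
  have e1 : w • (1 : ℝ) + (1 - w) • (x + a) = x := by
    simp only [smul_eq_mul]; linear_combination -hwD
  have e2 : (1 - w) • (1 : ℝ) + w • (x + a) = 1 + a := by
    simp only [smul_eq_mul]; linear_combination hwD
  rw [e1] at h1
  rw [e2] at h2
  simp only [smul_eq_mul, hφ.map_one, Real.log_one, mul_zero, zero_add] at h1 h2
  have p1 := hφ.pos hx
  have p2 := hφ.pos (by linarith : 1 ≤ 1 + a)
  rw [← Real.log_le_log_iff (hφ.pos (by linarith)) (mul_pos p1 p2),
    Real.log_mul p1.ne' p2.ne']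
  linarith

/-- The upper bound on `φ'/φ` makes `log φ - β log` decreasing. -/
theorem exists_le_mul_div_rpow (hφ : IsAdmissible φ) :
    ∃ β : ℝ, 0 < β ∧ ∀ x y, 1 ≤ x → x ≤ y → φ y ≤ φ x * (y / x) ^ β := by
  obtain ⟨γ, β, -, hβ, hb⟩ := hφ.logDeriv_bounds
  refine ⟨β, hβ, fun x y hx hxy => ?_⟩
  have hd : ∀ z, 1 < z → HasDerivAt (fun z => Real.log (φ z) - β * Real.log z)
      (derivWithin φ (Ici 1) z / φ z - β * z⁻¹) z := fun z hz =>
    ((hφ.hasDerivAt hz).log (hφ.pos hz.le).ne').sub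
      ((Real.hasDerivAt_log (by linarith)).const_mul β)
  have hanti : AntitoneOn (fun z => Real.log (φ z) - β * Real.log z) (Ici 1) := by
    refine antitoneOn_of_deriv_nonpos (convex_Ici 1) ?_ ?_ ?_
    · refine (hφ.differentiable.continuousOn.log fun z hz => (hφ.pos hz).ne').sub
        (continuousOn_const.mul (continuousOn_id.log fun z hz => ?_))
      exact (lt_of_lt_of_le one_pos (mem_Ici.1 hz)).ne'
    · intro z hz
      rw [interior_Ici] at hz
      exact (hd z hz).differentiableAt.differentiableWithinAt
    · intro z hz
      rw [interior_Ici] at hz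
      rw [(hd z hz).deriv, ← div_eq_mul_inv]
      linarith [(hb z (le_of_lt hz)).2]
  have h := hanti (mem_Ici.2 hx) (mem_Ici.2 (hx.trans hxy)) hxy
  simp only at h
  have hx0 : 0 < x := by linarith
  have hy0 : 0 < y := by linarith
  have hpx := hφ.pos hx
  have hpow : 0 < (y / x) ^ β := by positivity
  rw [← Real.log_le_log_iff (hφ.pos (hx.trans hxy)) (mul_pos hpx hpow),
    Real.log_mul hpx.ne' hpow.ne', Real.log_rpow (by positivity), Real.log_div hy0.ne' hx0.ne']
  linarith

theorem exists_le_mul_exp (hφ : IsAdmissible φ) :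
    ∃ C : ℝ, 0 < C ∧ ∀ δ u, 0 < δ → δ ≤ 1 → 0 ≤ u → φ (1 + u) ≤ C * φ δ⁻¹ * Real.exp (δ * u) := by
  obtain ⟨β, hβ, h⟩ := hφ.exists_le_mul_div_rpow
  -- The summand `1` serves `1 + u ≤ δ⁻¹`, where monotonicity suffices. Otherwise put `z = (1 +
  -- u)/δ⁻¹ = δu + δ`; then `log (z/β) ≤ z/β - 1` and `δ ≤ 1` give `β log z ≤ β log β - β + 1 + δu`.
  refine ⟨1 + Real.exp (β * Real.log β - β + 1), by positivity, fun δ u hδ hδ1 hu => ?_⟩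
  have hinv : 1 ≤ δ⁻¹ := (one_le_inv₀ hδ).2 hδ1
  have hp := hφ.pos hinv
  have hexp : 1 ≤ Real.exp (δ * u) := Real.one_le_exp (by positivity)
  have hE := Real.exp_pos (β * Real.log β - β + 1)
  rw [add_mul, one_mul, add_mul]
  rcases le_total (1 + u) δ⁻¹ with hle | hle
  · have h1 := hφ.monotoneOn (mem_Ici.2 (by linarith)) (mem_Ici.2 hinv) hle
    have h2 : φ δ⁻¹ ≤ φ δ⁻¹ * Real.exp (δ * u) := le_mul_of_one_le_right hp.le hexp
    have : 0 ≤ Real.exp (β * Real.log β - β + 1) * φ δ⁻¹ * Real.exp (δ * u) := by positivity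
    linarith
  · have h1 := h _ _ hinv hle
    have hx : 0 < (1 + u) / δ⁻¹ := by positivity
    have hxe : (1 + u) / δ⁻¹ = δ * u + δ := by field_simp; ring
    have hlog := Real.log_le_sub_one_of_pos (div_pos hx hβ)
    rw [Real.log_div hx.ne' hβ.ne'] at hlog
    have h3 : Real.log ((1 + u) / δ⁻¹) * β ≤ (β * Real.log β - β + 1) + δ * u := by
      have h4 := mul_le_mul_of_nonneg_right hlog hβ.le
      have h5 : ((1 + u) / δ⁻¹ / β - 1) * β = (1 + u) / δ⁻¹ - β := by field_simp
      rw [h5, hxe] at h4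
      rw [hxe]
      linarith
    have h6 : ((1 + u) / δ⁻¹) ^ β ≤
        Real.exp (β * Real.log β - β + 1) * Real.exp (δ * u) := by
      rw [Real.rpow_def_of_pos hx, ← Real.exp_add]
      exact Real.exp_le_exp.2 h3
    have h7 : φ δ⁻¹ * ((1 + u) / δ⁻¹) ^ β ≤
        Real.exp (β * Real.log β - β + 1) * φ δ⁻¹ * Real.exp (δ * u) := by
      rw [mul_comm (Real.exp _) (φ _), mul_assoc]
      gcongr
    have : 0 ≤ φ δ⁻¹ * Real.exp (δ * u) := by positivity
    linarith

end IsAdmissible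

/-! ### Weak-type estimates for the Calderón operator and the converse implication. -/

section CalderonBounds

theorem inv_sub_inv_mem {p₀ p : ℝ} (hp₀ : 1 < p₀) (hp : p₀ < p) :
    0 < 1 / p₀ - 1 / p ∧ 1 / p₀ - 1 / p < 1 := by
  have h1 := one_div_lt_one_div_of_lt (by linarith) hp
  have h2 : 1 / p₀ < 1 := (div_lt_one (by linarith)).2 hp₀
  have h3 : 0 < 1 / p := one_div_pos.2 (by linarith)
  constructor <;> linarith

theorem one_le_inv_sub_inv {p₀ p : ℝ} (hp₀ : 1 < p₀) (hp : p₀ < p) :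
    1 ≤ (1 / p₀ - 1 / p)⁻¹ :=
  (one_le_inv₀ (inv_sub_inv_mem hp₀ hp).1).2 (inv_sub_inv_mem hp₀ hp).2.le

theorem rpow_mul_calderonP_le {φ : ℝ → ℝ} {C : ℝ} (hC : 0 ≤ C)
    (h : ∀ δ u, 0 < δ → δ ≤ 1 → 0 ≤ u → φ (1 + u) ≤ C * φ δ⁻¹ * Real.exp (δ * u))
    {p₀ p t : ℝ} (hp₀ : 1 < p₀) (hp : p₀ < p) (hφ : 0 ≤ φ (1 / p₀ - 1 / p)⁻¹) (ht : 0 < t)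
    (F : ℝ → ℝ≥0∞) :
    ENNReal.ofReal (t ^ (1 / p)) * calderonP p₀ φ F t ≤
      ENNReal.ofReal (C * φ (1 / p₀ - 1 / p)⁻¹) *
        ∫⁻ r in Ioi (0 : ℝ), ENNReal.ofReal (r ^ (1 / p - 1)) * F r := by
  obtain ⟨hδ0, hδ1⟩ := inv_sub_inv_mem hp₀ hp
  rw [calderonP, ← mul_assoc, ← ENNReal.ofReal_mul (by positivity),
    ← lintegral_const_mul' _ _ ENNReal.ofReal_ne_top,
    ← lintegral_const_mul' _ _ ENNReal.ofReal_ne_top]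
  refine (setLIntegral_mono' measurableSet_Ioo fun r hr => ?_).trans
    (lintegral_mono_set Ioo_subset_Ioi_self)
  have hr0 := hr.1
  have hu : 0 ≤ -Real.log (r / t) := by
    have := Real.log_nonpos (div_pos hr0 ht).le ((div_le_one ht).2 hr.2.le)
    linarith
  have hb := h _ _ hδ0 hδ1.le hu
  rw [← sub_eq_add_neg] at hb
  set δ := 1 / p₀ - 1 / p with hδ
  have hexp : Real.exp (δ * -Real.log (r / t)) = t ^ δ * r ^ (-δ) := by
    rw [Real.log_div hr0.ne' ht.ne', Real.rpow_def_of_pos ht, Real.rpow_def_of_pos hr0,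
      ← Real.exp_add]
    congr 1
    ring
  rw [hexp] at hb
  have e1 : t ^ (1 / p) * t ^ (-(1 / p₀)) * t ^ δ = 1 := by
    rw [← Real.rpow_add ht, ← Real.rpow_add ht, hδ]
    ring_nf
    exact Real.rpow_zero t
  have e2 : r ^ (-δ) * r ^ (1 / p₀ - 1) = r ^ (1 / p - 1) := by
    rw [← Real.rpow_add hr0, hδ]
    ring_nf
  have hreal : t ^ (1 / p) * t ^ (-(1 / p₀)) * (φ (1 - Real.log (r / t)) * r ^ (1 / p₀ - 1)) ≤
      C * φ δ⁻¹ * r ^ (1 / p - 1) := by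
    calc _ ≤ t ^ (1 / p) * t ^ (-(1 / p₀)) *
          (C * φ δ⁻¹ * (t ^ δ * r ^ (-δ)) * r ^ (1 / p₀ - 1)) := by gcongr
      _ = C * φ δ⁻¹ * (t ^ (1 / p) * t ^ (-(1 / p₀)) * t ^ δ) *
          (r ^ (-δ) * r ^ (1 / p₀ - 1)) := by ring
      _ = _ := by rw [e1, e2, mul_one]
  calc _ = ENNReal.ofReal (t ^ (1 / p) * t ^ (-(1 / p₀)) *
        (φ (1 - Real.log (r / t)) * r ^ (1 / p₀ - 1))) * F r := by
        rw [ENNReal.ofReal_mul (p := t ^ (1 / p) * t ^ (-(1 / p₀))) (by positivity),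
          ENNReal.ofReal_mul' (q := r ^ (1 / p₀ - 1)) (by positivity)]
        ring
    _ ≤ ENNReal.ofReal (C * φ δ⁻¹ * r ^ (1 / p - 1)) * F r := by gcongr
    _ = _ := by rw [ENNReal.ofReal_mul (by positivity), mul_assoc]

/-- For `r > t` and `p ≤ p₁`, `t^{1/p - 1/p₁} ≤ r^{1/p - 1/p₁}`, so no constant is lost. -/
theorem rpow_mul_calderonQ_le {p p₁ t : ℝ} (hp0 : 0 < p) (hp : p ≤ p₁) (ht : 0 < t)
    (F : ℝ → ℝ≥0∞) :
    ENNReal.ofReal (t ^ (1 / p)) * calderonQ p₁ F t ≤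
        ∫⁻ r in Ioi (0 : ℝ), ENNReal.ofReal (r ^ (1 / p - 1)) * F r := by
  rw [calderonQ, ← mul_assoc, ← ENNReal.ofReal_mul (by positivity),
    ← lintegral_const_mul' _ _ ENNReal.ofReal_ne_top]
  refine (setLIntegral_mono' measurableSet_Ioi fun r hr => ?_).trans
    (lintegral_mono_set (Ioi_subset_Ioi ht.le))
  have htr : t < r := hr
  have hr0 : 0 < r := ht.trans htr
  have hε : 0 ≤ 1 / p - 1 / p₁ := sub_nonneg.2 (one_div_le_one_div_of_le hp0 hp)
  have hreal : t ^ (1 / p) * t ^ (-(1 / p₁)) * r ^ (1 / p₁ - 1) ≤ r ^ (1 / p - 1) := by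
    calc _ = t ^ (1 / p - 1 / p₁) * r ^ (1 / p₁ - 1) := by
          rw [← Real.rpow_add ht, ← sub_eq_add_neg]
      _ ≤ r ^ (1 / p - 1 / p₁) * r ^ (1 / p₁ - 1) := by gcongr
      _ = _ := by rw [← Real.rpow_add hr0]; ring_nf
  rw [mul_left_comm, ← ENNReal.ofReal_mul (by positivity), mul_comm]
  gcongr

theorem calderonR_mono {p₀ p₁ t : ℝ} (φ : ℝ → ℝ) {F G : ℝ → ℝ≥0∞} (h : ∀ r, F r ≤ G r) :
    calderonR p₀ p₁ φ F t ≤ calderonR p₀ p₁ φ G t := by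
  unfold calderonR calderonP calderonQ
  gcongr with r hr r hr <;> exact h _

end CalderonBounds

theorem SublinearOperator.restrictedWeakType_of_pointwiseBound {M N : Type*} [MeasurableSpace M]
    [MeasurableSpace N] {𝕜 : Type*} [RCLike 𝕜] {μ : Measure M} {ν : Measure N}
    {φ : ℝ → ℝ} (hφ : IsAdmissible φ) {C : ℝ} (hC : 0 < C)
    (h : ∀ δ u, 0 < δ → δ ≤ 1 → 0 ≤ u → φ (1 + u) ≤ C * φ δ⁻¹ * Real.exp (δ * u))
    {p₀ p₁ c : ℝ} (hp₀ : 1 < p₀) (hc : 0 < c) (T : SublinearOperator 𝕜 μ ν)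
    (hdom : lorentzSum 𝕜 μ p₀ p₁ ≤ T.domain)
    (hT : ∀ f : T.domain, (f : M →ₘ[μ] 𝕜) ∈ lorentzSum 𝕜 μ p₀ p₁ →
      T.PointwiseBound p₀ p₁ φ c f) {p : ℝ} (hp : p₀ < p) (hp' : p ≤ p₁) :
    T.RestrictedWeakType p (c * (C + 1) * φ ((1 / p₀ - 1 / p)⁻¹)) := by
  intro f hf
  have hmem : f ∈ lorentzSum 𝕜 μ p₀ p₁ := Submodule.subset_span ⟨p, hp, hp', hf⟩
  refine ⟨hdom hmem, iSup₂_le fun t ht => ?_⟩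
  have h1 := one_le_inv_sub_inv hp₀ hp
  set Φ := φ ((1 / p₀ - 1 / p)⁻¹) with hΦ
  have hΦ1 : 1 ≤ Φ := hφ.one_le _ h1
  calc _ ≤ ENNReal.ofReal (t ^ (1 / p)) *
        (ENNReal.ofReal c * calderonR p₀ p₁ φ (rearrangement μ f) t) := by
        gcongr
        exact hT ⟨f, hdom hmem⟩ hmem t ht
    _ = ENNReal.ofReal c * (ENNReal.ofReal (t ^ (1 / p)) * calderonP p₀ φ (rearrangement μ f) t +
        ENNReal.ofReal (t ^ (1 / p)) * calderonQ p₁ (rearrangement μ f) t) := by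
        rw [calderonR]; ring
    _ ≤ ENNReal.ofReal c * (ENNReal.ofReal (C * Φ) * lorentzNorm μ p f + lorentzNorm μ p f) := by
        gcongr ENNReal.ofReal c * (?_ + ?_)
        · exact rpow_mul_calderonP_le hC.le h hp₀ hp (by linarith) ht _
        · exact rpow_mul_calderonQ_le (by linarith) hp' ht _
    _ ≤ ENNReal.ofReal c * (ENNReal.ofReal (C * Φ) * lorentzNorm μ p f +
          ENNReal.ofReal Φ * lorentzNorm μ p f) := by
        gcongr
        exact le_mul_of_one_le_left' (ENNReal.one_le_ofReal.2 hΦ1)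
    _ = _ := by
        rw [← add_mul, ← ENNReal.ofReal_add (by positivity) (by positivity), ← mul_assoc,
          ← ENNReal.ofReal_mul hc.le]
        congr 2
        ring

theorem setLIntegral_Ioo_rpow_mul_const {p s : ℝ} (hp : 0 < p) (hs : 0 < s) (b : ℝ≥0∞) :
    ∫⁻ r in Ioo 0 s, ENNReal.ofReal (r ^ (1 / p - 1)) * b =
      ENNReal.ofReal (p * s ^ (1 / p)) * b := by
  rw [lintegral_mul_const _ (by fun_prop), setLIntegral_Ioo_rpow hp hs]

/-! ### Local integrability of rearrangements in the sum space. -/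

section LocalIntegrability

variable {M : Type*} [MeasurableSpace M] {𝕜 : Type*} [RCLike 𝕜] {μ : Measure M}

theorem setLIntegral_rpow_mul_comp_half_lt_top {F : ℝ → ℝ≥0∞} {e t : ℝ}
    (h : ∫⁻ r in Ioo 0 (t / 2), ENNReal.ofReal (r ^ e) * F r < ∞) :
    ∫⁻ r in Ioo 0 t, ENNReal.ofReal (r ^ e) * F (r / 2) < ∞ := by
  have himg : (fun x : ℝ => 2 * x) '' Ioo 0 (t / 2) = Ioo 0 t := by
    rw [image_mul_left_Ioo two_pos, mul_zero, mul_div_cancel₀ _ two_ne_zero]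
  rw [← himg, lintegral_image_eq_lintegral_abs_deriv_mul (f' := fun _ => 2) measurableSet_Ioo
    (fun x _ => by simpa using ((hasDerivAt_id x).const_mul (2 : ℝ)).hasDerivWithinAt)
    (mul_right_injective₀ two_ne_zero).injOn]
  calc _ = ∫⁻ r in Ioo 0 (t / 2), ENNReal.ofReal (2 * 2 ^ e) * (ENNReal.ofReal (r ^ e) * F r) := by
        refine setLIntegral_congr_fun measurableSet_Ioo fun r hr => ?_
        have hr0 : 0 < r := hr.1
        rw [mul_div_cancel_left₀ r two_ne_zero, abs_two, Real.mul_rpow zero_le_two hr0.le,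
          ENNReal.ofReal_mul zero_le_two, ENNReal.ofReal_mul (by positivity), mul_assoc, mul_assoc]
    _ < ∞ := by
        rw [lintegral_const_mul' _ _ ENNReal.ofReal_ne_top]
        exact ENNReal.mul_lt_top ENNReal.ofReal_lt_top h

theorem setLIntegral_rpow_lt_top_of_le {F : ℝ → ℝ≥0∞} {p p' t : ℝ} (hp : 0 < p) (hpp : p ≤ p')
    (h : ∫⁻ r in Ioo 0 t, ENNReal.ofReal (r ^ (1 / p' - 1)) * F r < ∞) :
    ∫⁻ r in Ioo 0 t, ENNReal.ofReal (r ^ (1 / p - 1)) * F r < ∞ := by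
  have he : 0 ≤ 1 / p - 1 / p' := sub_nonneg.2 (one_div_le_one_div_of_le hp hpp)
  calc _ ≤ ∫⁻ r in Ioo 0 t, ENNReal.ofReal (t ^ (1 / p - 1 / p')) *
        (ENNReal.ofReal (r ^ (1 / p' - 1)) * F r) := by
        refine setLIntegral_mono' measurableSet_Ioo fun r hr => ?_
        have hr0 : 0 < r := hr.1
        have ht0 : 0 < t := hr0.trans hr.2
        rw [← mul_assoc, ← ENNReal.ofReal_mul (by positivity)]
        gcongr
        calc r ^ (1 / p - 1) = r ^ (1 / p - 1 / p') * r ^ (1 / p' - 1) := by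
              rw [← Real.rpow_add hr0]; ring_nf
          _ ≤ _ := by gcongr; exact hr.2.le
    _ < ∞ := by
        rw [lintegral_const_mul' _ _ ENNReal.ofReal_ne_top]
        exact ENNReal.mul_lt_top ENNReal.ofReal_lt_top h

/-- On a bounded interval the condition weakens as the exponent decreases, so the smaller of two
exponents serves a sum. This single exponent later controls the top part of `f`. -/
theorem exists_setLIntegral_lt_top_of_mem_lorentzSum {p₀ p₁ : ℝ} (hp₀ : 0 < p₀) (hp : p₀ < p₁)
    {f : M →ₘ[μ] 𝕜} (hf : f ∈ lorentzSum 𝕜 μ p₀ p₁) :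
    ∃ p, p₀ < p ∧ p ≤ p₁ ∧ ∀ t : ℝ,
      ∫⁻ r in Ioo 0 t, ENNReal.ofReal (r ^ (1 / p - 1)) * rearrangement μ f r < ∞ := by
  induction hf using Submodule.span_induction with
  | mem f hf =>
    obtain ⟨p, h0, h1, hfin⟩ := hf
    exact ⟨p, h0, h1, fun t => lt_of_le_of_lt (lintegral_mono_set Ioo_subset_Ioi_self) hfin⟩
  | zero =>
    refine ⟨p₁, hp, le_rfl, fun t => ?_⟩
    have h0 : ∀ r, rearrangement μ ((0 : M →ₘ[μ] 𝕜) : M → 𝕜) r = 0 := fun r =>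
      nonpos_iff_eq_zero.1 <| rearrangement_le_of_ae_le (by
        filter_upwards [AEEqFun.coeFn_zero (μ := μ) (β := 𝕜)] with x hx
        simp [hx]) r
    simp [h0]
  | add f g _ _ ihf ihg =>
    obtain ⟨p, hp0, hp1, hf⟩ := ihf
    obtain ⟨p', hp0', hp1', hg⟩ := ihg
    have hm : 0 < min p p' := hp₀.trans (lt_min hp0 hp0')
    refine ⟨min p p', lt_min hp0 hp0', (min_le_left _ _).trans hp1, fun t => ?_⟩
    have hmeas : Measurable fun r => ENNReal.ofReal (r ^ (1 / min p p' - 1)) *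
        rearrangement μ f (r / 2) :=
      (measurable_id.pow_const _).ennreal_ofReal.mul
        ((rearrangement_anti f).measurable.comp (measurable_id.div_const 2))
    calc _ ≤ ∫⁻ r in Ioo 0 t, (ENNReal.ofReal (r ^ (1 / min p p' - 1)) *
          rearrangement μ f (r / 2) + ENNReal.ofReal (r ^ (1 / min p p' - 1)) *
          rearrangement μ g (r / 2)) := by
          refine setLIntegral_mono' measurableSet_Ioo fun r hr => ?_
          rw [← mul_add]
          gcongr
          refine rearrangement_add_le ?_ hr.1
          filter_upwards [AEEqFun.coeFn_add f g] with x hx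
          rw [hx]
          exact enorm_add_le _ _
      _ < ∞ := by
          rw [lintegral_add_left hmeas]
          exact ENNReal.add_lt_top.2
            ⟨setLIntegral_rpow_mul_comp_half_lt_top
              (setLIntegral_rpow_lt_top_of_le hm (min_le_left _ _) (hf _)),
            setLIntegral_rpow_mul_comp_half_lt_top
              (setLIntegral_rpow_lt_top_of_le hm (min_le_right _ _) (hg _))⟩
  | smul c f _ ih =>
    obtain ⟨p, hp0, hp1, hf⟩ := ih
    refine ⟨p, hp0, hp1, fun t => ?_⟩
    calc _ ≤ ∫⁻ r in Ioo 0 t, ‖c‖ₑ * (ENNReal.ofReal (r ^ (1 / p - 1)) * rearrangement μ f r) := by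
          refine lintegral_mono fun r => ?_
          rw [mul_left_comm]
          gcongr
          refine rearrangement_smul_le c ?_ r
          filter_upwards [AEEqFun.coeFn_smul c f] with x hx
          rw [hx, Pi.smul_apply, enorm_smul]
      _ < ∞ := by
          rw [lintegral_const_mul' _ _ enorm_ne_top]
          exact ENNReal.mul_lt_top enorm_lt_top (hf t)

theorem rearrangement_lt_top_of_setLIntegral {F : ℝ → ℝ≥0∞} (hF : Antitone F) {p t : ℝ}
    (hp : 0 < p) (ht : 0 < t)
    (h : ∫⁻ r in Ioo 0 t, ENNReal.ofReal (r ^ (1 / p - 1)) * F r < ∞) : F t < ∞ := by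
  have hle : ENNReal.ofReal (p * t ^ (1 / p)) * F t ≤
      ∫⁻ r in Ioo 0 t, ENNReal.ofReal (r ^ (1 / p - 1)) * F r := by
    rw [← setLIntegral_Ioo_rpow_mul_const hp ht]
    refine setLIntegral_mono' measurableSet_Ioo fun r hr => ?_
    gcongr
    exact hF hr.2.le
  have hpos : 0 < p * t ^ (1 / p) := by positivity
  exact ENNReal.lt_top_of_mul_ne_top_right (lt_of_le_of_lt hle h).ne
    (ENNReal.ofReal_pos.2 hpos).ne'

end LocalIntegrability

/-! ### Restrictions to level sets and their Lorentz norms. -/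

section Cut

variable {M : Type*} [MeasurableSpace M] {𝕜 : Type*} [RCLike 𝕜] {μ : Measure M}

/-- The restriction of `f` to a measurable set, extended by zero. -/
noncomputable def cut (f : M →ₘ[μ] 𝕜) (S : Set M) (hS : MeasurableSet S) : M →ₘ[μ] 𝕜 :=
  AEEqFun.mk (S.indicator f) (f.aestronglyMeasurable.indicator hS)

theorem coeFn_cut (f : M →ₘ[μ] 𝕜) {S : Set M} (hS : MeasurableSet S) :
    cut f S hS =ᵐ[μ] S.indicator f :=
  AEEqFun.coeFn_mk _ _

theorem cut_union (f : M →ₘ[μ] 𝕜) {S S' U : Set M} (hS : MeasurableSet S) (hS' : MeasurableSet S')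
    (hU : MeasurableSet U) (hd : Disjoint S S') (h : S ∪ S' = U) :
    cut f U hU = cut f S hS + cut f S' hS' := by
  subst h
  refine AEEqFun.ext ?_
  filter_upwards [coeFn_cut f hU, coeFn_cut f hS, coeFn_cut f hS',
    AEEqFun.coeFn_add (cut f S hS) (cut f S' hS')] with x h1 h2 h3 h4
  rw [h1, h4, Pi.add_apply, h2, h3, indicator_union_of_disjoint hd]

theorem cut_univ (f : M →ₘ[μ] 𝕜) : cut f univ MeasurableSet.univ = f := by
  refine AEEqFun.ext ?_
  filter_upwards [coeFn_cut f MeasurableSet.univ] with x hx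
  rw [hx, indicator_univ]

theorem rearrangement_cut_le (f : M →ₘ[μ] 𝕜) {S : Set M} (hS : MeasurableSet S) (t : ℝ) :
    rearrangement μ (cut f S hS) t ≤ rearrangement μ f t := by
  refine rearrangement_mono_ae ?_ t
  filter_upwards [coeFn_cut f hS] with x hx
  rw [hx]
  exact enorm_indicator_le_enorm_self _ _

theorem rearrangement_cut_le_of_subset (f : M →ₘ[μ] 𝕜) {S : Set M} (hS : MeasurableSet S)
    {b : ℝ≥0∞} (h : ∀ x ∈ S, ‖f x‖ₑ ≤ b) (t : ℝ) :
    rearrangement μ (cut f S hS) t ≤ b := by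
  refine rearrangement_le_of_ae_le ?_ t
  filter_upwards [coeFn_cut f hS] with x hx
  rw [hx]
  by_cases hxS : x ∈ S
  · rw [indicator_of_mem hxS]; exact h x hxS
  · simp [indicator_of_notMem hxS]

theorem rearrangement_cut_eq_zero (f : M →ₘ[μ] 𝕜) {S : Set M} (hS : MeasurableSet S) {s t : ℝ}
    (h : μ S ≤ ENNReal.ofReal s) (hst : s ≤ t) : rearrangement μ (cut f S hS) t = 0 := by
  refine rearrangement_eq_zero_of_support (S := S) ?_ h hst
  filter_upwards [coeFn_cut f hS] with x hx hxS
  rw [hx, indicator_of_notMem hxS]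

theorem lorentzNorm_le_add {g : M → 𝕜} {p s : ℝ} (hs : 0 < s) {G H : ℝ → ℝ≥0∞}
    (hG : ∀ r, 0 < r → r < s → rearrangement μ g r ≤ G r)
    (hH : ∀ r, s < r → rearrangement μ g r ≤ H r) :
    lorentzNorm μ p g ≤ (∫⁻ r in Ioo 0 s, ENNReal.ofReal (r ^ (1 / p - 1)) * G r) +
      ∫⁻ r in Ioi s, ENNReal.ofReal (r ^ (1 / p - 1)) * H r := by
  rw [lorentzNorm, ← Ioc_union_Ioi_eq_Ioi hs.le]
  refine (lintegral_union_le _ _ _).trans (add_le_add ?_ ?_)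
  · rw [← setLIntegral_congr Ioo_ae_eq_Ioc]
    exact setLIntegral_mono' measurableSet_Ioo fun r hr => by gcongr; exact hG r hr.1 hr.2
  · exact setLIntegral_mono' measurableSet_Ioi fun r hr => by gcongr; exact hH r hr

theorem measurableSet_lt_enorm (f : M →ₘ[μ] 𝕜) (b : ℝ≥0∞) : MeasurableSet {x | b < ‖f x‖ₑ} :=
  measurableSet_lt measurable_const f.stronglyMeasurable.enorm

theorem lorentzNorm_cut_head_le (f : M →ₘ[μ] 𝕜) {S : Set M} (hS : MeasurableSet S) {p s : ℝ}
    (hs : 0 < s) (h : μ S ≤ ENNReal.ofReal s) :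
    lorentzNorm μ p (cut f S hS) ≤
      ∫⁻ r in Ioo 0 s, ENNReal.ofReal (r ^ (1 / p - 1)) * rearrangement μ f r := by
  simpa using lorentzNorm_le_add (p := p) (H := 0) hs (fun r _ _ => rearrangement_cut_le f hS r)
    fun r hr => (rearrangement_cut_eq_zero f hS h hr.le).le

theorem lorentzNorm_cut_slice_le (f : M →ₘ[μ] 𝕜) {S : Set M} (hS : MeasurableSet S) {p s : ℝ}
    (hp : 0 < p) (hs : 0 < s) (h : μ S ≤ ENNReal.ofReal s) {b : ℝ≥0∞} (hb : ∀ x ∈ S, ‖f x‖ₑ ≤ b) :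
    lorentzNorm μ p (cut f S hS) ≤ ENNReal.ofReal (p * s ^ (1 / p)) * b := by
  have h1 := lorentzNorm_le_add (p := p) (H := 0) hs
    (fun r _ _ => rearrangement_cut_le_of_subset f hS hb r)
    fun r hr => (rearrangement_cut_eq_zero f hS h hr.le).le
  rw [setLIntegral_Ioo_rpow_mul_const hp hs] at h1
  simpa using h1

theorem lorentzNorm_cut_low_le (f : M →ₘ[μ] 𝕜) {S : Set M} (hS : MeasurableSet S) {p s : ℝ}
    (hp : 0 < p) (hs : 0 < s) {b : ℝ≥0∞} (hb : ∀ x ∈ S, ‖f x‖ₑ ≤ b) :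
    lorentzNorm μ p (cut f S hS) ≤ ENNReal.ofReal (s ^ (1 / p)) *
      (ENNReal.ofReal p * b + calderonQ p (rearrangement μ f) s) := by
  have h1 := lorentzNorm_le_add (p := p) hs
    (fun r _ _ => rearrangement_cut_le_of_subset f hS hb r)
    fun r _ => rearrangement_cut_le f hS r
  rw [setLIntegral_Ioo_rpow_mul_const hp hs] at h1
  refine h1.trans_eq ?_
  rw [calderonQ, mul_add, ← mul_assoc, ← mul_assoc, ← ENNReal.ofReal_mul (by positivity),
    ← ENNReal.ofReal_mul (by positivity), ← Real.rpow_add hs, add_neg_cancel, Real.rpow_zero,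
    ENNReal.ofReal_one, one_mul, mul_comm p]
  simp only [mul_comm]

end Cut

/-- Only finite subadditivity is available, so the remainder `v n` stays in the estimate. -/
theorem SublinearOperator.enorm_le_sum {M N : Type*} [MeasurableSpace M] [MeasurableSpace N]
    {𝕜 : Type*} [RCLike 𝕜] {μ : Measure M} {ν : Measure N} (T : SublinearOperator 𝕜 μ ν)
    {f w : T.domain} {u v : ℕ → T.domain} (hf : f = w + v 0) (hv : ∀ k, v k = u k + v (k + 1))
    (n : ℕ) : ∀ᵐ y ∂ν, ‖T.toFun f y‖ₑ ≤
      ‖T.toFun w y‖ₑ + (‖T.toFun (v n) y‖ₑ + ∑ k ∈ Finset.range n, ‖T.toFun (u k) y‖ₑ) := by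
  have hadd : ∀ g h : T.domain, ∀ᵐ y ∂ν,
      ‖T.toFun (g + h) y‖ₑ ≤ ‖T.toFun g y‖ₑ + ‖T.toFun h y‖ₑ := fun g h => by
    filter_upwards [T.map_add_le g h] with y hy
    rw [← ofReal_norm, ← ofReal_norm, ← ofReal_norm,
      ← ENNReal.ofReal_add (norm_nonneg _) (norm_nonneg _)]
    exact ENNReal.ofReal_le_ofReal hy
  induction n with
  | zero => simpa [hf] using hadd w (v 0)
  | succ n ih =>
    have h := hadd (u n) (v (n + 1))
    rw [← hv n] at h
    filter_upwards [ih, h] with y h1 h2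
    refine h1.trans ?_
    rw [Finset.sum_range_succ]
    refine add_le_add_right ?_ _
    calc _ ≤ ‖T.toFun (u n) y‖ₑ + ‖T.toFun (v (n + 1)) y‖ₑ +
          ∑ k ∈ Finset.range n, ‖T.toFun (u k) y‖ₑ := by gcongr
      _ = _ := by ring

/-! ### Comparing one slice with a piece of the Calderón integral. -/

section SliceEstimates

/-- Starting at `(1/q - 1/p₁)⁻¹` keeps every exponent at most `p₁` and makes the starting value
independent of `p₀ ≤ q`. -/
theorem exists_exponent {p₀ p₁ q : ℝ} (hp₀ : 1 < p₀) (hq : p₀ ≤ q) (hqp : q < p₁) (k : ℕ) :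
    ∃ p, p₀ < p ∧ p ≤ p₁ ∧ (1 / p₀ - 1 / p)⁻¹ = (1 / q - 1 / p₁)⁻¹ + k := by
  have hd : 0 < 1 / q - 1 / p₁ := (inv_sub_inv_mem (hp₀.trans_le hq) hqp).1
  have hk : (0 : ℝ) ≤ k := k.cast_nonneg
  have hX : 0 < (1 / q - 1 / p₁)⁻¹ + k := by positivity
  set δ := ((1 / q - 1 / p₁)⁻¹ + k)⁻¹ with hδ
  have hδ0 : 0 < δ := inv_pos.2 hX
  have hδd : δ ≤ 1 / q - 1 / p₁ := inv_le_of_inv_le₀ hd (le_add_of_nonneg_right hk)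
  have hq1 : 1 / q ≤ 1 / p₀ := one_div_le_one_div_of_le (by linarith) hq
  have hp1 : 0 < 1 / p₁ := one_div_pos.2 (by linarith)
  have hpos : 0 < 1 / p₀ - δ := by linarith
  refine ⟨1 / (1 / p₀ - δ), ?_, ?_, ?_⟩
  · rw [lt_one_div (by linarith) hpos]
    linarith
  · rw [one_div_le hpos (by linarith)]
    linarith
  · rw [one_div_one_div, sub_sub_cancel, hδ, inv_inv]

/-- Replacing `1/p` by `1/p₀` in the exponent of `e^{-k}` costs `e^{k/(D+k)} ≤ e`, and passing from
`k` to `k + 1` costs `e^{1/p₀} ≤ e`; hence `e²`. The `2` cancels the `1/2` on the right. -/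
theorem IsAdmissible.slice_constant_le {φ : ℝ → ℝ} (hφ : IsAdmissible φ) {C p₀ p p₁ D t k : ℝ}
    (hC : 0 ≤ C) (hp₀ : 1 < p₀) (hp : 0 < p) (hp₁ : p ≤ p₁) (hD : 1 ≤ D) (hk : 0 ≤ k)
    (hpk : (1 / p₀ - 1 / p)⁻¹ = D + k) (ht : 0 < t) :
    C * φ (1 / p₀ - 1 / p)⁻¹ * (p * (t * Real.exp (-k)) ^ (1 / p)) ≤
      t ^ (1 / p) * (C * φ D * p₁ * (2 * Real.exp 2)) *
        (φ (1 + k) * (Real.exp (-(k + 1) / p₀) / 2)) := by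
  have hφD := hφ.pos hD
  have hφk := hφ.pos (by linarith : 1 ≤ 1 + k)
  have hpow : (t * Real.exp (-k)) ^ (1 / p) ≤
      t ^ (1 / p) * (Real.exp 2 * Real.exp (-(k + 1) / p₀)) := by
    rw [Real.mul_rpow ht.le (Real.exp_pos _).le, ← Real.exp_mul, ← Real.exp_add]
    gcongr
    have hδ : 1 / p₀ - 1 / p = (D + k)⁻¹ := by rw [← hpk, inv_inv]
    have h1 : 1 / p = 1 / p₀ - (D + k)⁻¹ := by linarith
    have h2 : k * (D + k)⁻¹ ≤ 1 := by
      rw [← div_eq_mul_inv, div_le_one (by linarith)]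
      linarith
    have h3 : 1 / p₀ ≤ 1 := ((div_lt_one (by linarith)).2 hp₀).le
    have h4 : -(k + 1) / p₀ = -k * (1 / p₀) - 1 / p₀ := by ring
    rw [h1, h4]
    linarith
  have hmul := hφ.map_add_le_mul hD hk
  have hp₁0 : 0 < p₁ := by linarith
  rw [hpk]
  calc C * φ (D + k) * (p * (t * Real.exp (-k)) ^ (1 / p)) ≤
        C * (φ D * φ (1 + k)) *
          (p₁ * (t ^ (1 / p) * (Real.exp 2 * Real.exp (-(k + 1) / p₀)))) := by gcongr
    _ = _ := by ring

/-- On this interval all three factors of the integrand are at least the values used, by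
monotonicity (`1/p₀ - 1 ≤ 0` for the power), and its length is at least half its right endpoint
because `e ≥ 2`. The interval ends at `s_{k+1}` since slice `k` has height up to `F(s_{k+1})`. -/
theorem IsAdmissible.le_setLIntegral_slice {φ : ℝ → ℝ} (hφ : IsAdmissible φ) {p₀ t k : ℝ}
    (hp₀ : 1 < p₀) (hk : 0 ≤ k) (ht : 0 < t) {F : ℝ → ℝ≥0∞} (hF : Antitone F) :
    ENNReal.ofReal (φ (1 + k) * (Real.exp (-(k + 1) / p₀) / 2)) * F (t * Real.exp (-(k + 1))) ≤
      ENNReal.ofReal (t ^ (-(1 / p₀))) *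
        ∫⁻ r in Ioc (t * Real.exp (-(k + 2))) (t * Real.exp (-(k + 1))),
          ENNReal.ofReal (φ (1 - Real.log (r / t))) * F r * ENNReal.ofReal (r ^ (1 / p₀ - 1)) := by
  set b := t * Real.exp (-(k + 1)) with hb
  have hb0 : 0 < b := by positivity
  have hφk := hφ.pos (by linarith : 1 ≤ 1 + k)
  have hp₀' : 1 / p₀ ≤ 1 := ((div_lt_one (by linarith)).2 hp₀).le
  have hlen : b / 2 ≤ b - t * Real.exp (-(k + 2)) := by
    have h1 : t * Real.exp (-(k + 2)) = b * Real.exp (-1) := by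
      rw [hb, mul_assoc, ← Real.exp_add]; ring_nf
    have h2 : Real.exp (-1) ≤ 1 / 2 := by
      rw [Real.exp_neg, ← one_div]
      exact one_div_le_one_div_of_le two_pos (by linarith [Real.add_one_le_exp (1 : ℝ)])
    rw [h1]
    have := mul_le_mul_of_nonneg_left h2 hb0.le
    linarith
  have hconst : φ (1 + k) * (Real.exp (-(k + 1) / p₀) / 2) =
      t ^ (-(1 / p₀)) * (φ (1 + k) * b ^ (1 / p₀ - 1) * (b / 2)) := by
    have h1 : b ^ (1 / p₀ - 1) * b = t ^ (1 / p₀) * Real.exp (-(k + 1) / p₀) := by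
      rw [← Real.rpow_add_one hb0.ne', sub_add_cancel, hb,
        Real.mul_rpow ht.le (Real.exp_pos _).le, ← Real.exp_mul, mul_one_div]
    have h2 : t ^ (-(1 / p₀)) * t ^ (1 / p₀) = 1 := by
      rw [← Real.rpow_add ht, neg_add_cancel, Real.rpow_zero]
    linear_combination (-(t ^ (-(1 / p₀))) * φ (1 + k) / 2) * h1 -
      (φ (1 + k) * Real.exp (-(k + 1) / p₀) / 2) * h2
  rw [hconst, ENNReal.ofReal_mul (by positivity), mul_assoc]
  gcongr
  calc ENNReal.ofReal (φ (1 + k) * b ^ (1 / p₀ - 1) * (b / 2)) * F b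
      ≤ ENNReal.ofReal (φ (1 + k) * b ^ (1 / p₀ - 1) * (b - t * Real.exp (-(k + 2)))) * F b := by
        gcongr
    _ = ∫⁻ _ in Ioc (t * Real.exp (-(k + 2))) b,
          ENNReal.ofReal (φ (1 + k)) * F b * ENNReal.ofReal (b ^ (1 / p₀ - 1)) := by
        rw [setLIntegral_const, Real.volume_Ioc, ENNReal.ofReal_mul (by positivity),
          ENNReal.ofReal_mul (by positivity)]
        ring
    _ ≤ _ := by
        refine setLIntegral_mono' measurableSet_Ioc fun r hr => ?_
        have hr0 : 0 < r := lt_trans (by positivity) hr.1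
        have hlog : Real.log (r / t) ≤ -(k + 1) := by
          rw [Real.log_le_iff_le_exp (by positivity), div_le_iff₀ ht, mul_comm]
          exact hr.2
        gcongr ENNReal.ofReal ?_ * ?_ * ENNReal.ofReal ?_
        · exact hφ.monotoneOn (mem_Ici.2 (by linarith)) (mem_Ici.2 (by linarith)) (by linarith)
        · exact hF hr.2
        · exact Real.rpow_le_rpow_of_nonpos hr0 hr.2 (by linarith)

theorem IsAdmissible.le_calderonP {φ : ℝ → ℝ} (hφ : IsAdmissible φ) {p₀ t : ℝ}
    (hp₀ : 1 < p₀) (ht : 0 < t) {F : ℝ → ℝ≥0∞} (hF : Antitone F) : F t ≤ calderonP p₀ φ F t := by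
  calc F t ≤ ENNReal.ofReal p₀ * F t := le_mul_of_one_le_left' (ENNReal.one_le_ofReal.2 hp₀.le)
    _ = ENNReal.ofReal (t ^ (-(1 / p₀))) *
        ∫⁻ r in Ioo 0 t, ENNReal.ofReal (r ^ (1 / p₀ - 1)) * F t := by
        rw [setLIntegral_Ioo_rpow_mul_const (by linarith) ht, ← mul_assoc,
          ← ENNReal.ofReal_mul (by positivity), mul_left_comm, ← Real.rpow_add ht, neg_add_cancel,
          Real.rpow_zero, mul_one]
    _ ≤ _ := by
        rw [calderonP]
        refine mul_le_mul_right (setLIntegral_mono' measurableSet_Ioo fun r hr => ?_) _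
        have hlog := Real.log_nonpos (div_pos hr.1 ht).le ((div_le_one ht).2 hr.2.le)
        rw [mul_comm]
        gcongr
        refine (hF hr.2.le).trans (le_mul_of_one_le_left' (ENNReal.one_le_ofReal.2 ?_))
        exact hφ.one_le _ (by linarith)

theorem sum_setLIntegral_slice_le {t : ℝ} (ht : 0 < t) (G : ℝ → ℝ≥0∞) (n : ℕ) :
    ∑ k ∈ Finset.range n,
        ∫⁻ r in Ioc (t * Real.exp (-((k : ℝ) + 2))) (t * Real.exp (-((k : ℝ) + 1))), G r ≤
      ∫⁻ r in Ioo 0 t, G r := by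
  have hanti : Antitone fun k : ℕ => t * Real.exp (-((k : ℝ) + 1)) := fun m n hmn => by
    have : (m : ℝ) ≤ n := Nat.cast_le.2 hmn
    simp only
    gcongr
  have hd := hanti.pairwise_disjoint_on_Ioc_succ
  have hs : ∀ k : ℕ, Ioc (t * Real.exp (-((k : ℝ) + 2))) (t * Real.exp (-((k : ℝ) + 1))) =
      Ioc (t * Real.exp (-(((Order.succ k : ℕ) : ℝ) + 1))) (t * Real.exp (-((k : ℝ) + 1))) :=
    fun k => by
      rw [Nat.succ_eq_succ, Nat.cast_succ]
      ring_nf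
  simp_rw [hs]
  rw [← lintegral_biUnion_finset (fun i _ j _ hij => hd hij) fun _ _ => measurableSet_Ioc]
  refine lintegral_mono_set (iUnion₂_subset fun k _ r hr => ⟨lt_trans (by positivity) hr.1,
    lt_of_le_of_lt hr.2 ?_⟩)
  have hk : (0 : ℝ) ≤ k := k.cast_nonneg
  exact mul_lt_of_lt_one_right ht (Real.exp_lt_one_iff.2 (by linarith))

end SliceEstimates

/-! ### The decomposition argument and passage to the limit. -/

namespace SublinearOperator

variable {M N : Type*} [MeasurableSpace M] [MeasurableSpace N] {𝕜 : Type*} [RCLike 𝕜]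
  {μ : Measure M} {ν : Measure N} {φ : ℝ → ℝ} {T : SublinearOperator 𝕜 μ ν}

theorem RestrictedWeakType.bound {p A : ℝ} (h : T.RestrictedWeakType p A) {f : T.domain}
    {b : ℝ≥0∞} (hb : b < ∞) (hf : lorentzNorm μ p (f : M →ₘ[μ] 𝕜) ≤ b) :
    weakLorentzNorm ν p (T.toFun f) ≤ ENNReal.ofReal A * b := by
  obtain ⟨hfd, hw⟩ := h f (lt_of_le_of_lt hf hb)
  exact hw.trans (by gcongr)

theorem rearrangement_le_calderonR_add (hφ : IsAdmissible φ) {p₀ p₁ q C : ℝ} (hC : 0 < C)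
    (hp₀ : 1 < p₀) (hq : p₀ ≤ q) (hqp : q < p₁)
    (hT : ∀ p, p₀ < p → p ≤ p₁ → T.RestrictedWeakType p (C * φ ((1 / p₀ - 1 / p)⁻¹)))
    (f : T.domain) {p : ℝ} (hpp₀ : p₀ < p) (hpp₁ : p ≤ p₁)
    (hfp : ∀ t : ℝ, ∫⁻ r in Ioo 0 t, ENNReal.ofReal (r ^ (1 / p - 1)) *
      rearrangement μ (f : M →ₘ[μ] 𝕜) r < ∞) {t : ℝ} (ht : 0 < t)
    (hQ : calderonQ p₁ (rearrangement μ (f : M →ₘ[μ] 𝕜)) t < ∞) (n : ℕ) :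
    rearrangement ν (T.toFun f) t ≤ ENNReal.ofReal (p₀ / (p₀ - 1)) *
      (ENNReal.ofReal (C * φ (1 / q - 1 / p₁)⁻¹ * p₁ * (1 + 2 * Real.exp 2)) *
          calderonR p₀ p₁ φ (rearrangement μ (f : M →ₘ[μ] 𝕜)) t +
        ENNReal.ofReal (t ^ (-(1 / p)) * (C * φ ((1 / p₀ - 1 / p)⁻¹))) *
          ∫⁻ r in Ioo 0 (t * Real.exp (-(n : ℝ))), ENNReal.ofReal (r ^ (1 / p - 1)) *
            rearrangement μ (f : M →ₘ[μ] 𝕜) r) := by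
  set g : M →ₘ[μ] 𝕜 := f.1 with hg
  set F := rearrangement μ g with hF
  have hFanti : Antitone F := rearrangement_anti g
  have hp1 : 1 < p := hp₀.trans hpp₀
  have hp₁ : 1 < p₁ := hp1.trans_le hpp₁
  have hFtop : ∀ s, 0 < s → F s < ∞ := fun s hs =>
    rearrangement_lt_top_of_setLIntegral hFanti (by linarith) hs (hfp s)
  have hD1 : 1 ≤ (1 / q - 1 / p₁)⁻¹ := one_le_inv_sub_inv (hp₀.trans_le hq) hqp
  set D := (1 / q - 1 / p₁)⁻¹ with hD
  have hφD := hφ.pos hD1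
  let s : ℕ → ℝ := fun k => t * Real.exp (-(k : ℝ))
  have hs0 : ∀ k, 0 < s k := fun k => mul_pos ht (Real.exp_pos _)
  have hs_zero : s 0 = t := by simp [s]
  have hsanti : Antitone s := fun m n hmn => by
    have : (m : ℝ) ≤ n := Nat.cast_le.2 hmn
    simp only [s]
    gcongr
  let E : ℕ → Set M := fun k => {x | F (s k) < ‖g x‖ₑ}
  have hEm : ∀ k, MeasurableSet (E k) := fun k => measurableSet_lt_enorm g _
  have hEμ : ∀ k, μ (E k) ≤ ENNReal.ofReal (s k) := fun k => distribution_rearrangement_le g _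
  have hEsub : ∀ k, E (k + 1) ⊆ E k := fun k x hx =>
    lt_of_le_of_lt (hFanti (hsanti k.le_succ)) hx
  have hSm : ∀ k, MeasurableSet (E k \ E (k + 1)) := fun k => (hEm k).diff (hEm (k + 1))
  have hSμ : ∀ k, μ (E k \ E (k + 1)) ≤ ENNReal.ofReal (s k) := fun k =>
    (measure_mono sdiff_subset).trans (hEμ k)
  have hhead : ∀ k, lorentzNorm μ p (cut g (E k) (hEm k)) ≤
      ∫⁻ r in Ioo 0 (s k), ENNReal.ofReal (r ^ (1 / p - 1)) * F r := fun k =>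
    lorentzNorm_cut_head_le g (hEm k) (hs0 k) (hEμ k)
  have hlow := lorentzNorm_cut_low_le g (hEm 0).compl (p := p₁) (by linarith) ht (b := F t)
    fun x hx => by simpa [E, hs_zero] using hx
  have hslice : ∀ (p' : ℝ) (_ : 0 < p') (k : ℕ), lorentzNorm μ p' (cut g (E k \ E (k + 1)) (hSm k)) ≤
      ENNReal.ofReal (p' * s k ^ (1 / p')) * F (s (k + 1)) := fun p' hp' k =>
    lorentzNorm_cut_slice_le g (hSm k) hp' (hs0 k) (hSμ k) fun x hx => not_lt.1 hx.2
  have hlow_top : ENNReal.ofReal (t ^ (1 / p₁)) * (ENNReal.ofReal p₁ * F t + calderonQ p₁ F t) < ∞ :=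
    ENNReal.mul_lt_top ENNReal.ofReal_lt_top (ENNReal.add_lt_top.2
      ⟨ENNReal.mul_lt_top ENNReal.ofReal_lt_top (hFtop t ht), hQ⟩)
  have hslice_top : ∀ (p' : ℝ) (k : ℕ),
      ENNReal.ofReal (p' * s k ^ (1 / p')) * F (s (k + 1)) < ∞ := fun p' k =>
    ENNReal.mul_lt_top ENNReal.ofReal_lt_top (hFtop _ (hs0 _))
  have hp₀₁ : p₀ < p₁ := hq.trans_lt hqp
  obtain ⟨hwd, -⟩ := hT p₁ hp₀₁ le_rfl _ (lt_of_le_of_lt hlow hlow_top)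
  have hvd : ∀ k, cut g (E k) (hEm k) ∈ T.domain := fun k =>
    (hT p hpp₀ hpp₁ _ (lt_of_le_of_lt (hhead k) (hfp _))).1
  have hud : ∀ k, cut g (E k \ E (k + 1)) (hSm k) ∈ T.domain := fun k =>
    (hT p hpp₀ hpp₁ _ (lt_of_le_of_lt (hslice p (by linarith) k) (hslice_top p k))).1
  let w : T.domain := ⟨_, hwd⟩
  let v : ℕ → T.domain := fun k => ⟨_, hvd k⟩
  let u : ℕ → T.domain := fun k => ⟨_, hud k⟩
  have hf : f = w + v 0 := Subtype.ext <| by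
    have := cut_union g (hEm 0).compl (hEm 0) MeasurableSet.univ disjoint_compl_left
      (compl_union_self _)
    rw [cut_univ] at this
    exact this
  have hv : ∀ k, v k = u k + v (k + 1) := fun k => Subtype.ext <|
    cut_union g (hSm k) (hEm (k + 1)) (hEm k) disjoint_sdiff_left (sdiff_union_of_subset (hEsub k))
  choose P hP0 hP1 hPD using exists_exponent hp₀ hq hqp
  -- The share of `P_{p₀,φ} F(t)` that pays for slice `k`.
  let J : ℕ → ℝ≥0∞ := fun k => ENNReal.ofReal (t ^ (-(1 / p₀))) *
    ∫⁻ r in Ioc (t * Real.exp (-((k : ℝ) + 2))) (t * Real.exp (-((k : ℝ) + 1))),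
      ENNReal.ofReal (φ (1 - Real.log (r / t))) * F r * ENNReal.ofReal (r ^ (1 / p₀ - 1))
  have hJ : ∑ k ∈ Finset.range n, J k ≤ calderonP p₀ φ F t := by
    rw [← Finset.mul_sum, calderonP]
    gcongr
    exact sum_setLIntegral_slice_le ht _ n
  set B := C * φ D * p₁ with hB
  have hB0 : 0 < B := by positivity
  have hw_weak : weakLorentzNorm ν p₁ (T.toFun w) ≤ ENNReal.ofReal (t ^ (1 / p₁)) *
      (ENNReal.ofReal B * calderonR p₀ p₁ φ F t) := by
    refine ((hT p₁ hp₀₁ le_rfl).bound (f := w) hlow_top hlow).trans ?_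
    rw [mul_left_comm]
    refine mul_le_mul_right ?_ _
    -- `p₀ ≤ q` gives `(1/p₀ - 1/p₁)⁻¹ ≤ D`; this keeps the constant uniform in `p₀`.
    have h1 : C * φ ((1 / p₀ - 1 / p₁)⁻¹) ≤ C * φ D := by
      have hd := (inv_sub_inv_mem (hp₀.trans_le hq) hqp).1
      refine mul_le_mul_of_nonneg_left (hφ.monotoneOn (mem_Ici.2 (one_le_inv_sub_inv hp₀ hp₀₁))
        (mem_Ici.2 hD1) ?_) hC.le
      rw [hD]
      gcongr
    calc _ ≤ ENNReal.ofReal (C * φ D) * (ENNReal.ofReal p₁ * calderonP p₀ φ F t +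
          ENNReal.ofReal p₁ * calderonQ p₁ F t) := by
          gcongr ENNReal.ofReal ?_ * (ENNReal.ofReal _ * ?_ + ?_)
          · exact hφ.le_calderonP hp₀ ht hFanti
          · exact le_mul_of_one_le_left' (ENNReal.one_le_ofReal.2 hp₁.le)
      _ = _ := by
          rw [hB, ENNReal.ofReal_mul (p := C * φ D) (by positivity), calderonR]
          ring
  have hu_weak : ∀ k, weakLorentzNorm ν (P k) (T.toFun (u k)) ≤ ENNReal.ofReal (t ^ (1 / P k)) *
      (ENNReal.ofReal (B * (2 * Real.exp 2)) * J k) := fun k => by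
    have hPpos : 0 < P k := by linarith [hP0 k]
    have hk : (0 : ℝ) ≤ k := k.cast_nonneg
    refine ((hT (P k) (hP0 k) (hP1 k)).bound (f := u k) (hslice_top _ k) (hslice _ hPpos k)).trans ?_
    have h1 := hφ.slice_constant_le hC.le hp₀ hPpos (hP1 k) hD1 hk (hPD k) ht
    have h2 := hφ.le_setLIntegral_slice hp₀ hk ht hFanti
    have hφk := hφ.pos (by linarith : (1 : ℝ) ≤ 1 + k)
    have hsk : s (k + 1) = t * Real.exp (-((k : ℝ) + 1)) := by simp [s]
    have hφP := hφ.pos (one_le_inv_sub_inv hp₀ (hP0 k))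
    calc _ = ENNReal.ofReal (C * φ ((1 / p₀ - 1 / P k)⁻¹) * (P k * s k ^ (1 / P k))) *
          F (s (k + 1)) := by
          rw [← mul_assoc, ← ENNReal.ofReal_mul (by positivity)]
      _ ≤ ENNReal.ofReal (t ^ (1 / P k) * (B * (2 * Real.exp 2)) *
          (φ (1 + k) * (Real.exp (-((k : ℝ) + 1) / p₀) / 2))) * F (s (k + 1)) := by
          gcongr
      _ = ENNReal.ofReal (t ^ (1 / P k)) * (ENNReal.ofReal (B * (2 * Real.exp 2)) *
          (ENNReal.ofReal (φ (1 + k) * (Real.exp (-((k : ℝ) + 1) / p₀) / 2)) *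
            F (s (k + 1)))) := by
          rw [ENNReal.ofReal_mul (p := t ^ (1 / P k) * (B * (2 * Real.exp 2))) (by positivity),
            ENNReal.ofReal_mul (p := t ^ (1 / P k)) (by positivity)]
          ring
      _ ≤ _ := by
          rw [hsk]
          gcongr
  have hv_weak : weakLorentzNorm ν p (T.toFun (v n)) ≤ ENNReal.ofReal (t ^ (1 / p)) *
      (ENNReal.ofReal (t ^ (-(1 / p)) * (C * φ ((1 / p₀ - 1 / p)⁻¹))) *
          ∫⁻ r in Ioo 0 (s n), ENNReal.ofReal (r ^ (1 / p - 1)) * F r) := by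
    refine ((hT p hpp₀ hpp₁).bound (f := v n) (hfp _) (hhead n)).trans_eq ?_
    rw [← mul_assoc, ← ENNReal.ofReal_mul (by positivity), ← mul_assoc, ← Real.rpow_add ht,
      add_neg_cancel, Real.rpow_zero, one_mul]
  -- The index type encodes the low part, the top part and the `n` slices, with exponents `p₁`, `p`
  -- and `P k`, all at least `p₀`.
  have hsum := rearrangement_sum_le (ν := ν) (h := T.toFun f)
    (Finset.univ : Finset (Option (Option (Fin n))))
    (g := fun i => i.elim (T.toFun w) fun j => j.elim (T.toFun (v n)) fun k => T.toFun (u k))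
    (p := fun i => i.elim p₁ fun j => j.elim p fun k => P k) (p₀ := p₀) (t := t)
    (a := fun i => i.elim (ENNReal.ofReal B * calderonR p₀ p₁ φ F t) fun j => j.elim
      (ENNReal.ofReal (t ^ (-(1 / p)) * (C * φ ((1 / p₀ - 1 / p)⁻¹))) *
          ∫⁻ r in Ioo 0 (s n), ENNReal.ofReal (r ^ (1 / p - 1)) * F r)
      fun k => ENNReal.ofReal (B * (2 * Real.exp 2)) * J k)
    (by rintro (_ | _ | k) - <;> exact AEEqFun.aestronglyMeasurable _) hp₀
    (by rintro (_ | _ | k) -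
        · exact hp₀₁.le
        · exact hpp₀.le
        · exact (hP0 k).le) ht
    (by rintro (_ | _ | k) -
        · exact hw_weak
        · exact hv_weak
        · exact hu_weak k)
    (by filter_upwards [T.enorm_le_sum hf hv n] with y hy
        simpa [Fintype.sum_option, Finset.sum_range] using hy)
  simp only [Fintype.sum_option, Option.elim_none, Option.elim_some] at hsum
  rw [← Finset.sum_range (fun k => ENNReal.ofReal (B * (2 * Real.exp 2)) * J k),
    ← Finset.mul_sum] at hsum
  refine hsum.trans (mul_le_mul_right ?_ _)
  calc _ ≤ ENNReal.ofReal B * calderonR p₀ p₁ φ F t +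
        (ENNReal.ofReal (t ^ (-(1 / p)) * (C * φ ((1 / p₀ - 1 / p)⁻¹))) *
          (∫⁻ r in Ioo 0 (s n), ENNReal.ofReal (r ^ (1 / p - 1)) * F r) +
        ENNReal.ofReal (B * (2 * Real.exp 2)) * calderonR p₀ p₁ φ F t) := by
        gcongr
        exact hJ.trans le_self_add
    _ = _ := by
        rw [mul_add B, mul_one, ENNReal.ofReal_add (by positivity) (by positivity)]
        ring

theorem pointwiseBound_of_mem_lorentzSum (hφ : IsAdmissible φ) {p₀ p₁ q C : ℝ} (hC : 0 < C)
    (hp₀ : 1 < p₀) (hq : p₀ ≤ q) (hqp : q < p₁)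
    (hT : ∀ p, p₀ < p → p ≤ p₁ → T.RestrictedWeakType p (C * φ ((1 / p₀ - 1 / p)⁻¹)))
    (f : T.domain) (hf : (f : M →ₘ[μ] 𝕜) ∈ lorentzSum 𝕜 μ p₀ p₁) :
    T.PointwiseBound p₀ p₁ φ
      (p₁ * (C * φ (1 / q - 1 / p₁)⁻¹ * p₁ * (1 + 2 * Real.exp 2)) * (1 / (p₀ - 1))) f := by
  intro t ht
  have hp₀1 : 0 < p₀ - 1 := by linarith
  have hp₀₁ : p₀ < p₁ := hq.trans_lt hqp
  have hp₁ : 0 < p₁ := by linarith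
  have hφD := hφ.pos (one_le_inv_sub_inv (hp₀.trans_le hq) hqp)
  set B := C * φ (1 / q - 1 / p₁)⁻¹ * p₁ * (1 + 2 * Real.exp 2) with hB
  have hB0 : 0 < B := by positivity
  have hA0 : 0 < p₁ * B * (1 / (p₀ - 1)) := by positivity
  set F := rearrangement μ (f : M →ₘ[μ] 𝕜) with hF
  rcases eq_or_ne (calderonQ p₁ F t) ∞ with hQ | hQ
  · have : calderonR p₀ p₁ φ F t = ∞ := by rw [calderonR, hQ, add_top]
    rw [this, ENNReal.mul_top (ENNReal.ofReal_pos.2 hA0).ne']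
    exact le_top
  obtain ⟨p, hpp₀, hpp₁, hfin⟩ :=
    exists_setLIntegral_lt_top_of_mem_lorentzSum (by linarith) hp₀₁ hf
  have hmain := rearrangement_le_calderonR_add hφ hC hp₀ hq hqp hT f hpp₀ hpp₁ hfin ht
    (lt_top_iff_ne_top.2 hQ)
  -- The top part disappears by absolute continuity of the integral over the shrinking intervals
  -- `(0, t e^{-n})`.
  have hvol : Tendsto (volume.restrict (Ioo 0 t) ∘ fun n : ℕ => Ioo 0 (t * Real.exp (-(n : ℝ))))
      atTop (nhds 0) := by
    have h1 : Tendsto (fun n : ℕ => ENNReal.ofReal (t * Real.exp (-(n : ℝ)))) atTop (nhds 0) := by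
      have := (Real.tendsto_exp_neg_atTop_nhds_zero.comp
        tendsto_natCast_atTop_atTop).const_mul t
      rw [mul_zero] at this
      simpa using ENNReal.tendsto_ofReal this
    refine tendsto_of_tendsto_of_tendsto_of_le_of_le tendsto_const_nhds h1 (fun _ => zero_le)
      fun n => (Measure.restrict_apply_le _ _).trans_eq ?_
    simp [Real.volume_Ioo]
  have htail := tendsto_setLIntegral_zero (hfin t).ne hvol
  have htail' : Tendsto (fun n : ℕ => ∫⁻ r in Ioo 0 (t * Real.exp (-(n : ℝ))),
      ENNReal.ofReal (r ^ (1 / p - 1)) * F r) atTop (nhds 0) := by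
    refine htail.congr fun n => ?_
    rw [Measure.restrict_restrict measurableSet_Ioo, inter_eq_left.2]
    refine Ioo_subset_Ioo_right (mul_le_of_le_one_right ht.le (Real.exp_le_one_iff.2 ?_))
    simp
  have hlim := ENNReal.Tendsto.const_mul (a := ENNReal.ofReal (p₀ / (p₀ - 1)))
    ((ENNReal.Tendsto.const_mul
      (a := ENNReal.ofReal (t ^ (-(1 / p)) * (C * φ ((1 / p₀ - 1 / p)⁻¹)))) htail'
      (Or.inr ENNReal.ofReal_ne_top)).const_add (ENNReal.ofReal B * calderonR p₀ p₁ φ F t))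
    (Or.inr ENNReal.ofReal_ne_top)
  refine (ge_of_tendsto' hlim hmain).trans ?_
  rw [mul_zero, add_zero, ← mul_assoc, ← ENNReal.ofReal_mul (by positivity)]
  -- Bounding the numerator `p₀` by `p₁` leaves `1/(p₀ - 1)` as the only dependence on `p₀`.
  have hle : p₀ / (p₀ - 1) * B ≤ p₁ * B * (1 / (p₀ - 1)) := by
    rw [div_mul_eq_mul_div, mul_one_div]
    gcongr
  exact mul_le_mul_left (ENNReal.ofReal_le_ofReal hle) _

theorem PointwiseBound.of_approximable {p₀ p₁ A : ℝ}
    (h : ∀ f : T.domain, (f : M →ₘ[μ] 𝕜) ∈ lorentzSum 𝕜 μ p₀ p₁ → T.PointwiseBound p₀ p₁ φ A f)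
    {f : T.domain} (hf : T.Approximable p₀ p₁ f) : T.PointwiseBound p₀ p₁ φ A f := by
  obtain ⟨g, hg, hgf, hlim⟩ := hf
  refine fun t ht => rearrangement_le_of_liminf hlim fun n => (h (g n) (hg n) t ht).trans ?_
  gcongr
  refine calderonR_mono φ fun r => rearrangement_mono_ae ?_ r
  filter_upwards [hgf n] with x hx
  exact enorm_le_iff_norm_le.2 hx

end SublinearOperator

theorem theorem3p1 {𝕜 : Type*} [RCLike 𝕜] (φ : ℝ → ℝ) (hφ : IsAdmissible φ) (p₁ : ℝ) :
    -- from the norm bounds to the pointwise bound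
    (∀ q C : ℝ, 1 < q → q < p₁ → 0 < C → ∃ K : ℝ, 0 < K ∧ ∀ p₀ : ℝ, 1 < p₀ → p₀ ≤ q →
      ∀ (M N : Type*) [MeasurableSpace M] [MeasurableSpace N] (μ : Measure M) (ν : Measure N)
        (T : SublinearOperator 𝕜 μ ν),
        (∀ p : ℝ, p₀ < p → p ≤ p₁ → T.RestrictedWeakType p (C * φ ((1 / p₀ - 1 / p)⁻¹))) →
        (∀ f : T.domain, (f : M →ₘ[μ] 𝕜) ∈ lorentzSum 𝕜 μ p₀ p₁ →
          T.PointwiseBound p₀ p₁ φ (K * (1 / (p₀ - 1))) f) ∧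
        (∀ f : T.domain, T.Approximable p₀ p₁ f →
          T.PointwiseBound p₀ p₁ φ (K * (1 / (p₀ - 1))) f)) ∧
    -- from the pointwise bound to the norm bounds
    (∀ c : ℝ, 0 < c → ∃ C : ℝ, 0 < C ∧ ∀ p₀ : ℝ, 1 < p₀ → p₀ < p₁ →
      ∀ (M N : Type*) [MeasurableSpace M] [MeasurableSpace N] (μ : Measure M) (ν : Measure N)
        (T : SublinearOperator 𝕜 μ ν),
        lorentzSum 𝕜 μ p₀ p₁ ≤ T.domain →
        (∀ f : T.domain, (f : M →ₘ[μ] 𝕜) ∈ lorentzSum 𝕜 μ p₀ p₁ →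
          T.PointwiseBound p₀ p₁ φ c f) →
        ∀ p : ℝ, p₀ < p → p ≤ p₁ → T.RestrictedWeakType p (C * φ ((1 / p₀ - 1 / p)⁻¹))) := by
  constructor
  · intro q C hq hqp hC
    have hφD := hφ.pos (one_le_inv_sub_inv hq hqp)
    have hp₁ : 0 < p₁ := by linarith
    refine ⟨p₁ * (C * φ (1 / q - 1 / p₁)⁻¹ * p₁ * (1 + 2 * Real.exp 2)), by positivity,
      fun p₀ hp₀ hp₀q M N _ _ μ ν T hT => ?_⟩
    have h := T.pointwiseBound_of_mem_lorentzSum hφ hC hp₀ hp₀q hqp hT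
    exact ⟨h, fun f hf => .of_approximable h hf⟩
  · intro c hc
    obtain ⟨C, hC, h⟩ := hφ.exists_le_mul_exp
    exact ⟨c * (C + 1), by positivity, fun p₀ hp₀ _ M N _ _ μ ν T hdom hT p hp hp' =>
      T.restrictedWeakType_of_pointwiseBound hφ hC h hp₀ hc hdom hT hp hp'⟩
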